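/- **Setting.** Let $\Delta>0$, $\alpha\in(0,2)$, $\sigma>0$, and let $\Theta\subseteq\mathbb R^{N}$ be a parameter set, $\vartheta_0\in\Theta$. For $\vartheta\in\Theta$ let $a_1(\vartheta),\dots,a_p(\vartheta),c_0(\vartheta),\dots,c_{p-1}(\vartheta)\in\mathbb R$ with $a_p(\vartheta)\ne0$ and some $c_j(\vartheta)\neq 0$; let $A(\vartheta)\in\mathbb R^{p\times p}$ be the companion matrix with ones on the superdiagonal and last row $(-a_p(\vartheta),\dots,-a_1(\vartheta))$, let $q(\vartheta)=\min\{j\in\{0,\dots,p-1\}:c_l(\vartheta)=0\ \forall\, l>j\}$ and $c(\vartheta)=(c_{q(\vartheta)}(\vartheta),\dots,c_0(\vartheta),0,\dots,0)^\top\in\mathbb R^p$, and let $e_p$ be the $p$-th unit vector. Let $\Omega(\vartheta)$ be the positive semidefinite solution of $$\Omega=e^{A\Delta}\Omega e^{A^\top\Delta}+\int_0^\Delta e^{Au}e_pe_p^\top e^{A^\top u}du-(e^{A\Delta}\Omega c)(c^\top\Omega c)^{-1}(e^{A\Delta}\Omega c)^\top$$ (with $A=A(\vartheta)$, $c=c(\vartheta)$),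 let $K(\vartheta)=(e^{A\Delta}\Omega c)(c^\top\Omega c)^{-1}$, and put $$\Pi(z,\vartheta)=1-c^\top\big(I_p-(e^{A\Delta}-Kc^\top)z\big)^{-1}Kz,\qquad g(t)=c(\vartheta_0)^\top e^{A(\vartheta_0)t}e_p\mathbf 1_{[0,\infty)}(t).$$ **Assumptions.** $\Theta$ is compact and $\vartheta_0$ is an interior point of $\Theta$; for all $\vartheta\in\Theta$ the eigenvalues of $A(\vartheta)$ have strictly negative real parts, have imaginary parts in $(-\pi/\Delta,\pi/\Delta)$, and are not zeros of $c_\vartheta(z)=c_0(\vartheta)z^{q(\vartheta)}+\dots+c_{q(\vartheta)}(\vartheta)$; for all $\vartheta_1\neq\vartheta_2$ in $\Theta$ one has $(c(\vartheta_1),A(\vartheta_1))\ne(c(\vartheta_2),A(\vartheta_2))$ and there is $z\in\mathbb C$ with $|z|=1$ and $\Pi(z,\vartheta_1)\ne\Pi(z,\vartheta_2)$; the maps $A(\cdot)$ and $c(\cdot)$ are three times continuously differentiable. **Stable laws.** For $r\in(0,2]$, $r\ne1$, $s>0$, $\beta\in[-1,1]$, $\mu\in\mathbb R$, $S_r(s,\beta,\mu)$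 denotes the law with characteristic function $z\mapsto\exp\{-s^r|z|^r(1-i\beta\,\mathrm{sign}(z)\tan(\pi r/2))+i\mu z\}$. Let $C_r=\frac{1-r}{\Gamma(2-r)\cos(\pi r/2)}$ for $r\ne1$ and $C_1=2/\pi$. Let $L=(L_t)_{t\ge0}$ be an $\alpha/2$-stable Lévy process with zero location, that is, a Lévy process with $L_t-L_s\sim S_{\alpha/2}(\tau(t-s)^{2/\alpha},1,0)$ for $s<t$, where $\tau=\sigma^2(C_\alpha/C_{\alpha/2})^{2/\alpha}$; so $L_1\sim S_{\alpha/2}(\tau,1,0)$. The integral $\int_0^\Delta f(s)\,dL_s$ of a deterministic $f\in L^{\alpha/2}[0,\Delta]$ is the limit in probability of the integrals of step functions converging to $f$ in $L^{\alpha/2}[0,\Delta]$. **Corollary 4.2.** Under these assumptions the stochastic integrals $$W^{(\alpha)}(\vartheta)=\frac1{2\pi}\int_0^\Delta\Big[\int_{-\pi}^{\pi}|\Pi(e^{i\omega},\vartheta)|^2\Big|\sum_{j=-\infty}^{\infty}g(\Delta j-s)e^{-ij\omega}\Big|^2d\omega\Big]dL_s,\qquad\vartheta\in\Theta,$$ exist.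 Define $G_{\vartheta,\vartheta_0}:[0,\Delta]\to\mathbb R$ by $$G_{\vartheta,\vartheta_0}(u)=\frac1{2\pi}\int_{-\pi}^{\pi}\big[|\Pi(e^{i\omega},\vartheta)|^2-|\Pi(e^{i\omega},\vartheta_0)|^2\big]\Big|\sum_{j=-\infty}^{\infty}g(\Delta j-u)e^{-ij\omega}\Big|^2d\omega .$$ Then, for every $\vartheta\in\Theta$ with $\vartheta\neq\vartheta_0$ (and whichever versions of the integrals are chosen), $$W^{(\alpha)}(\vartheta)-W^{(\alpha)}(\vartheta_0)\sim S_{\alpha/2}(\sigma_{\vartheta,\vartheta_0},\beta_{\vartheta,\vartheta_0},0),$$ with $\sigma_{\vartheta,\vartheta_0}>0$, where, with $x^{+}=\max\{0,x\}$ and $x^-=\max\{0,-x\}$, $$\beta_{\vartheta,\vartheta_0}=\frac{\int_0^\Delta (G^+_{\vartheta,\vartheta_0}(s))^{\alpha/2}-(G^-_{\vartheta,\vartheta_0}(s))^{\alpha/2}\,ds}{\int_0^\Delta|G_{\vartheta,\vartheta_0}(s)|^{\alpha/2}ds},\qquad \sigma_{\vartheta,\vartheta_0}^{\alpha/2}=\frac{\sigma^\alpha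 C_\alpha}{C_{\alpha/2}}\int_0^\Delta|G_{\vartheta,\vartheta_0}(s)|^{\alpha/2}ds .$$ -/

import Mathlib

open MeasureTheory ProbabilityTheory Filter Topology
open scoped NNReal ENNReal Matrix

noncomputable section

namespace StableCarma

/-! ### Stable laws and stable Lévy processes -/

/-- The exponent `φ` of the characteristic function `z ↦ exp (φ z)` of the law
`S_r(σ, β, m)`. -/
def stableExponent (r σ β m z : ℝ) : ℂ :=
  if r = 1 then
    -((σ * |z| : ℝ) : ℂ) *
        (1 + Complex.I * ((β * SignType.sign z * (2 / Real.pi) * Real.log |z| : ℝ) : ℂ))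
      + Complex.I * ((m * z : ℝ) : ℂ)
  else
    -((σ ^ r * |z| ^ r : ℝ) : ℂ) *
        (1 - Complex.I * ((β * SignType.sign z * Real.tan (Real.pi * r / 2) : ℝ) : ℂ))
      + Complex.I * ((m * z : ℝ) : ℂ)

/-- `X ∼ S_r(σ, β, m)`: the random variable `X` is `r`-stable with scale `σ > 0`,
skewness `β ∈ [-1, 1]` and location `m`. -/
structure HasStableLaw {Ω : Type*} [MeasurableSpace Ω] (X : Ω → ℝ) (P : Measure Ω)
    (r σ β m : ℝ) : Prop where
  aemeasurable : AEMeasurable X P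
  index_mem : r ∈ Set.Ioc (0 : ℝ) 2
  scale_pos : 0 < σ
  skew_mem : β ∈ Set.Icc (-1 : ℝ) 1
  charFun_eq : ∀ z : ℝ, charFun (P.map X) z = Complex.exp (stableExponent r σ β m z)

/-- The constant `C_r` of the tail behaviour of stable laws. -/
def stableConst (r : ℝ) : ℝ :=
  if r = 1 then 2 / Real.pi
  else (1 - r) / (Real.Gamma (2 - r) * Real.cos (Real.pi * r / 2))

/-- One-sided real Lévy processes: started at zero, with independent and stationary increments,
continuous in probability. -/
structure IsLevyProcess {Ω : Type*} [MeasurableSpace Ω] (L : ℝ≥0 → Ω → ℝ) (P : Measure Ω) :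
    Prop where
  aemeasurable : ∀ t, AEMeasurable (L t) P
  zero : ∀ᵐ ω ∂P, L 0 ω = 0
  indep : HasIndepIncrements L P
  stationary : ∀ s h : ℝ≥0, IdentDistrib (fun ω => L (s + h) ω - L s ω) (L h) P P
  continuous : ∀ t : ℝ≥0, TendstoInMeasure P L (𝓝 t) (L t)

/-- `r`-stable Lévy processes with zero location (for `r ≠ 1`):
`L_t - L_s ∼ S_r(σ (t - s)^{1/r}, β, 0)` for `s < t`. In particular `L_1 ∼ S_r(σ, β, 0)`. -/
structure IsStableLevyProcess {Ω : Type*} [MeasurableSpace Ω] (L : ℝ≥0 → Ω → ℝ) (P : Measure Ω)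
    (r σ β : ℝ) : Prop extends IsLevyProcess L P where
  increment : ∀ s t : ℝ≥0, s < t →
    HasStableLaw (fun ω => L t ω - L s ω) P r (σ * ((t : ℝ) - s) ^ (1 / r)) β 0

/-! ### The stochastic integral of a deterministic function -/

/-- A step function `∑_{i < n} c_i 1_{(t_i, t_{i+1}]}` with `0 ≤ t_0 ≤ … ≤ t_n ≤ T`. -/
structure StepFunction (T : ℝ) where
  n : ℕ
  t : ℕ → ℝ≥0
  c : ℕ → ℝ
  mono : Monotone t
  le : (t n : ℝ) ≤ T

/-- The value of a step function at `s`. -/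
def StepFunction.eval {T : ℝ} (φ : StepFunction T) (s : ℝ) : ℝ :=
  ∑ i ∈ Finset.range φ.n,
    φ.c i * (Set.Ioc (φ.t i : ℝ) (φ.t (i + 1) : ℝ)).indicator (fun _ => (1 : ℝ)) s

/-- The elementary stochastic integral `∑_{i < n} c_i (L_{t_{i+1}} - L_{t_i})`. -/
def StepFunction.integral {T : ℝ} (φ : StepFunction T) {Ω : Type*} (L : ℝ≥0 → Ω → ℝ) (ω : Ω) : ℝ :=
  ∑ i ∈ Finset.range φ.n, φ.c i * (L (φ.t (i + 1)) ω - L (φ.t i) ω)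

/-- `J` is (a version of) the stochastic integral `∫_0^T f(s) dL_s` of the deterministic function
`f ∈ L^r[0,T]` with respect to an `r`-stable Lévy process `L`: the limit in probability of the
elementary integrals of step functions that converge to `f` in `L^r[0,T]`. -/
def IsStableIntegral {Ω : Type*} [MeasurableSpace Ω] (L : ℝ≥0 → Ω → ℝ) (P : Measure Ω)
    (r T : ℝ) (f : ℝ → ℝ) (J : Ω → ℝ) : Prop :=
  AEMeasurable f (volume.restrict (Set.Ioc 0 T)) ∧ AEMeasurable J P ∧
    ∃ φ : ℕ → StepFunction T,
      Tendsto (fun k => ∫⁻ s in Set.Ioc 0 T, ENNReal.ofReal (|(φ k).eval s - f s| ^ r))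
        atTop (𝓝 0) ∧
      TendstoInMeasure P (fun k => (φ k).integral L) atTop J

/-! ### CARMA models -/

/-- The coefficients of a CARMA model of autoregressive order `p`:
`ar j = a_j` for `1 ≤ j ≤ p` and `ma j = c_j` for `0 ≤ j ≤ p - 1`; other values are not used. -/
structure CarmaCoeffs where
  ar : ℕ → ℝ
  ma : ℕ → ℝ

namespace CarmaCoeffs

variable (p : ℕ) (M : CarmaCoeffs)

/-- The companion matrix `A`, with ones above the diagonal and last row `(-a_p, …, -a_1)`. -/
def A : Matrix (Fin p) (Fin p) ℝ :=
  Matrix.of fun i j =>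
    if (i : ℕ) + 1 = p then -M.ar (p - j) else if (j : ℕ) = i + 1 then 1 else 0

/-- The moving average order: the smallest `j ≤ p - 1` with `c_l = 0` for all `l > j`. -/
def q : ℕ := sInf {j : ℕ | j < p ∧ ∀ l, j < l → l < p → M.ma l = 0}

/-- The vector `c = (c_q, c_{q-1}, …, c_0, 0, …, 0)`. -/
def c : Fin p → ℝ := fun i => if (i : ℕ) ≤ M.q p then M.ma (M.q p - i) else 0

/-- The last unit vector `e_p` of `ℝ^p`. -/
def e : Fin p → ℝ := fun i => if (i : ℕ) + 1 = p then 1 else 0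

/-- The moving average polynomial `c_0 z^q + c_1 z^{q-1} + … + c_q`. -/
def maPoly (z : ℂ) : ℂ := ∑ k ∈ Finset.range (M.q p + 1), (M.ma k : ℂ) * z ^ (M.q p - k)

/-- The matrix exponential `e^{A t}`. -/
def expA (t : ℝ) : Matrix (Fin p) (Fin p) ℝ := NormedSpace.exp (t • M.A p)

/-- The kernel `g(t) = cᵀ e^{A t} e_p 1_{[0,∞)}(t)`. -/
def kernel (t : ℝ) : ℝ := if 0 ≤ t then M.c p ⬝ᵥ (M.expA p t *ᵥ e p) else 0

variable (Δ : ℝ)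

/-- The matrix `∫_0^Δ e^{A u} e_p e_pᵀ e^{Aᵀ u} du`. -/
def noiseCov : Matrix (Fin p) (Fin p) ℝ :=
  Matrix.of fun i j =>
    ∫ u in (0 : ℝ)..Δ,
      (M.expA p u * Matrix.vecMulVec (e p) (e p) * (M.expA p u)ᵀ) i j

/-- The gain vector `(e^{A Δ} S c) (cᵀ S c)⁻¹` belonging to a covariance matrix `S`. -/
def gainOf (S : Matrix (Fin p) (Fin p) ℝ) : Fin p → ℝ :=
  (M.c p ⬝ᵥ (S *ᵥ M.c p))⁻¹ • (M.expA p Δ *ᵥ (S *ᵥ M.c p))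

/-- `S` is a positive semidefinite solution of the discrete-time algebraic Riccati equation. -/
def IsRiccatiSol (S : Matrix (Fin p) (Fin p) ℝ) : Prop :=
  S.PosSemidef ∧
    S = M.expA p Δ * S * (M.expA p Δ)ᵀ + M.noiseCov p Δ
      - Matrix.vecMulVec (M.gainOf p Δ S) (M.expA p Δ *ᵥ (S *ᵥ M.c p))

open Classical in
/-- The positive semidefinite solution `Ω^{(Δ)}` of the Riccati equation (it exists and is unique
when all the eigenvalues of `A` have negative real parts and `c ≠ 0`). -/
def riccati : Matrix (Fin p) (Fin p) ℝ :=
  if h : ∃ S, M.IsRiccatiSol p Δ S then h.choose else 0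

/-- The Kalman gain `K^{(Δ)}`. -/
def gain : Fin p → ℝ := M.gainOf p Δ (M.riccati p Δ)

/-- The matrix `e^{A Δ} - K cᵀ`. -/
def F : Matrix (Fin p) (Fin p) ℝ := M.expA p Δ - Matrix.vecMulVec (M.gain p Δ) (M.c p)

/-- The transfer function
`Π^{(Δ)}(z) = 1 - cᵀ (I - (e^{A Δ} - K cᵀ) z)⁻¹ K z`. -/
def transfer (z : ℂ) : ℂ :=
  1 - (fun i => (M.c p i : ℂ)) ⬝ᵥ
    ((1 - z • (M.F p Δ).map (fun x : ℝ => (x : ℂ)))⁻¹ *ᵥ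
      (z • fun i => (M.gain p Δ i : ℂ)))

/-- `|∑_{j ∈ ℤ} g(Δ j - u) e^{-i j ω}|²`. -/
def kernelPower (u ω : ℝ) : ℝ :=
  ‖∑' j : ℤ, (M.kernel p (Δ * j - u) : ℂ) * Complex.exp (-(Complex.I * j * ω))‖ ^ 2

/-- `|Π^{(Δ)}(e^{iω})|²`. -/
def transferPower (ω : ℝ) : ℝ := ‖M.transfer p Δ (Complex.exp (Complex.I * ω))‖ ^ 2

end CarmaCoeffs

/-- The standing assumptions on the parametric family `ϑ ↦ M ϑ`, `ϑ ∈ Θ ⊆ ℝ^N`, of CARMA models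
with autoregressive order `p` and true parameter `ϑ₀`, sampled at distance `Δ`. (The assumption
`ma_ne` forces `p ≥ 1`.) -/
structure StandingAssumptions {N : ℕ} (p : ℕ) (Δ : ℝ) (Θ : Set (EuclideanSpace ℝ (Fin N)))
    (ϑ₀ : EuclideanSpace ℝ (Fin N)) (M : EuclideanSpace ℝ (Fin N) → CarmaCoeffs) : Prop where
  ar_ne : ∀ ϑ ∈ Θ, (M ϑ).ar p ≠ 0
  ma_ne : ∀ ϑ ∈ Θ, ∃ j < p, (M ϑ).ma j ≠ 0
  compact : IsCompact Θ
  mem_interior : ϑ₀ ∈ interior Θ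
  stable : ∀ ϑ ∈ Θ, ∀ z ∈ spectrum ℂ (((M ϑ).A p).map (fun x : ℝ => (x : ℂ))), z.re < 0
  coprime : ∀ ϑ ∈ Θ, ∀ z ∈ spectrum ℂ (((M ϑ).A p).map (fun x : ℝ => (x : ℂ))),
    (M ϑ).maPoly p z ≠ 0
  injective : ∀ ϑ ∈ Θ, ∀ ϑ' ∈ Θ, ϑ ≠ ϑ' → ((M ϑ).c p, (M ϑ).A p) ≠ ((M ϑ').c p, (M ϑ').A p)
  aliasing : ∀ ϑ ∈ Θ, ∀ z ∈ spectrum ℂ (((M ϑ).A p).map (fun x : ℝ => (x : ℂ))),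
    -(Real.pi / Δ) < z.im ∧ z.im < Real.pi / Δ
  identifiable : ∀ ϑ ∈ Θ, ∀ ϑ' ∈ Θ, ϑ ≠ ϑ' →
    ∃ z : ℂ, ‖z‖ = 1 ∧ (M ϑ).transfer p Δ z ≠ (M ϑ').transfer p Δ z
  smooth_A : ∀ i j, ContDiffOn ℝ 3 (fun ϑ => (M ϑ).A p i j) Θ
  smooth_c : ∀ i, ContDiffOn ℝ 3 (fun ϑ => (M ϑ).c p i) Θ

section Limit

variable {N : ℕ} (p : ℕ) (Δ : ℝ) (Θ : Set (EuclideanSpace ℝ (Fin N)))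
  (ϑ₀ : EuclideanSpace ℝ (Fin N)) (M : EuclideanSpace ℝ (Fin N) → CarmaCoeffs)

/-- `W` is (a version of) the limit field
`W(ϑ) = (1/2π) ∫_0^Δ [∫_{-π}^{π} |Π(e^{iω}, ϑ)|² |∑_j g(Δj - s) e^{-ijω}|² dω] dL_s`, `ϑ ∈ Θ`,
where `g` is the kernel at the true parameter and `L` is `r`-stable. -/
def IsLimitField {Ω : Type*} [MeasurableSpace Ω] (L : ℝ≥0 → Ω → ℝ) (P : Measure Ω) (r : ℝ)
    (W : EuclideanSpace ℝ (Fin N) → Ω → ℝ) : Prop :=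
  ∀ ϑ ∈ Θ, ∃ J : Ω → ℝ,
    IsStableIntegral L P r Δ
      (fun s => ∫ w in (-Real.pi)..Real.pi,
        (M ϑ).transferPower p Δ w * (M ϑ₀).kernelPower p Δ s w) J ∧
    ∀ ω, W ϑ ω = 1 / (2 * Real.pi) * J ω

/-- The function `G_{ϑ,ϑ₀}` on `[0, Δ]`. -/
def G (ϑ : EuclideanSpace ℝ (Fin N)) (u : ℝ) : ℝ :=
  1 / (2 * Real.pi) * ∫ w in (-Real.pi)..Real.pi,
    ((M ϑ).transferPower p Δ w - (M ϑ₀).transferPower p Δ w) * (M ϑ₀).kernelPower p Δ u w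

/-- The skewness `β_{ϑ,ϑ₀}`. -/
def limitSkew (α : ℝ) (ϑ : EuclideanSpace ℝ (Fin N)) : ℝ :=
  (∫ s in (0 : ℝ)..Δ,
      ((max 0 (G p Δ ϑ₀ M ϑ s)) ^ (α / 2) - (max 0 (-G p Δ ϑ₀ M ϑ s)) ^ (α / 2))) /
    ∫ s in (0 : ℝ)..Δ, |G p Δ ϑ₀ M ϑ s| ^ (α / 2)

/-- The scale `σ_{ϑ,ϑ₀}`, determined by
`σ_{ϑ,ϑ₀}^{α/2} = σ^α C_α / C_{α/2} ∫_0^Δ |G_{ϑ,ϑ₀}(s)|^{α/2} ds`. -/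
def limitScale (α σ : ℝ) (ϑ : EuclideanSpace ℝ (Fin N)) : ℝ :=
  (σ ^ α * stableConst α / stableConst (α / 2) *
    ∫ s in (0 : ℝ)..Δ, |G p Δ ϑ₀ M ϑ s| ^ (α / 2)) ^ (2 / α)

end Limit

end StableCarma

end

/-! Put r = α/2 < 1. For step functions, independence of increments gives the characteristic
function exp(-τ^r ∫ ψ(z f)) of ∫ f dL, with ψ = `stableSymbol r`. Since ψ is r-Hölder, the formula
passes to L^r limits (`IsStableIntegral.charFun_eq`). The integral is linear, so W(ϑ) - W(ϑ₀) is a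
stable integral of G, and homogeneity of ψ gives scale and skewness
(`IsStableIntegral.hasStableLaw`). Existence follows from uniform step approximation and
completeness in probability, as the integrands agree on (0, Δ] with continuous functions.

The real content is that the scale is positive: G must not vanish almost everywhere. The stronger
fact proved is ∫_0^Δ G > 0 (`integral_limitGap_pos`). By Fubini only the average of the kernel power
over u ∈ [0, Δ] matters. The Riccati equation factorizes it as V |Ψ(e^{iω})|², where V = cᵀΩc > 0
and Ψ = 1/Π(·, ϑ₀) (`hermForm_noiseCov_resolventRow`, `transfer_mul_innovationTransfer`). Hence ∫ G
= V/(2π) ∫ (|H|² - 1) with H = Π(·, ϑ)Ψ. Here H is analytic on the closed disc and H(0) = 1, so the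
mean of |H|² is 1 plus the mean of |H - 1|²; this exceeds 1 by identifiability.

Two facts about the Riccati equation enter. A solution exists: iterate from the noise covariance,
which is positive definite by controllability, and bound the increasing iterates by a Lyapunov
function of e^{AΔ}. Every positive semidefinite solution is stabilizing, because in Joseph form it
solves a Lyapunov equation for F = e^{AΔ} - Kcᵀ; uniqueness is never needed. -/

namespace StableCarma

/-! ### The characteristic exponent of totally skewed stable laws -/

/-- The function `x ↦ |x|^r (1 - i sign(x) tan(π r / 2))`. -/
noncomputable def stableSymbol (r x : ℝ) : ℂ :=
  ((max 0 x ^ r : ℝ) : ℂ) * (1 - Complex.I * (Real.tan (Real.pi * r / 2) : ℝ)) +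
    ((max 0 (-x) ^ r : ℝ) : ℂ) * (1 + Complex.I * (Real.tan (Real.pi * r / 2) : ℝ))

/-- The Hölder constant of `stableSymbol r`. -/
noncomputable def stableSymbolConst (r : ℝ) : ℝ :=
  ‖1 - Complex.I * (Real.tan (Real.pi * r / 2) : ℝ)‖ +
    ‖1 + Complex.I * (Real.tan (Real.pi * r / 2) : ℝ)‖

lemma stableSymbolConst_nonneg (r : ℝ) : 0 ≤ stableSymbolConst r := by
  unfold stableSymbolConst; positivity

lemma stableSymbol_zero {r : ℝ} (hr : 0 < r) : stableSymbol r 0 = 0 := by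
  simp [stableSymbol, Real.zero_rpow hr.ne']

/-- Subadditivity of t ↦ t^r for r ≤ 1, applied to x = (x - y) + y. -/
lemma abs_rpow_sub_rpow_le {r x y : ℝ} (hr : 0 ≤ r) (hr1 : r ≤ 1) (hx : 0 ≤ x) (hy : 0 ≤ y) :
    |x ^ r - y ^ r| ≤ |x - y| ^ r := by
  wlog h : y ≤ x generalizing x y
  · rw [abs_sub_comm, abs_sub_comm x]
    exact this hy hx (le_of_not_ge h)
  rw [abs_of_nonneg (sub_nonneg.2 (Real.rpow_le_rpow hy h hr)), abs_of_nonneg (sub_nonneg.2 h)]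
  have := Real.rpow_add_le_add_rpow (sub_nonneg.2 h) hy hr hr1
  rw [sub_add_cancel] at this
  linarith

/-- Positive and negative parts are 1-Lipschitz and t ↦ t^r is r-Hölder. This bound turns L^r
convergence of integrands into L¹ convergence of the exponents. -/
lemma norm_stableSymbol_sub_le {r : ℝ} (hr : 0 ≤ r) (hr1 : r ≤ 1) (x y : ℝ) :
    ‖stableSymbol r x - stableSymbol r y‖ ≤ stableSymbolConst r * |x - y| ^ r := by
  have key : ∀ a b : ℝ, |max 0 a ^ r - max 0 b ^ r| ≤ |a - b| ^ r := fun a b =>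
    (abs_rpow_sub_rpow_le hr hr1 (le_max_left _ _) (le_max_left _ _)).trans
      (Real.rpow_le_rpow (abs_nonneg _) (by
        have := abs_max_sub_max_le_max 0 a 0 b
        simpa using this) hr)
  have h1 := key x y
  have h2 := key (-x) (-y)
  rw [show |-x - -y| = |x - y| by rw [← abs_neg]; congr 1; ring] at h2
  have e : stableSymbol r x - stableSymbol r y =
      ((max 0 x ^ r - max 0 y ^ r : ℝ) : ℂ) * (1 - Complex.I * (Real.tan (Real.pi * r / 2) : ℝ)) +
      ((max 0 (-x) ^ r - max 0 (-y) ^ r : ℝ) : ℂ) *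
        (1 + Complex.I * (Real.tan (Real.pi * r / 2) : ℝ)) := by
    simp only [stableSymbol]; push_cast; ring
  rw [e, stableSymbolConst, add_mul]
  refine (norm_add_le _ _).trans (add_le_add ?_ ?_)
  · rw [norm_mul, mul_comm, Complex.norm_real, Real.norm_eq_abs]
    gcongr
  · rw [norm_mul, mul_comm, Complex.norm_real, Real.norm_eq_abs]
    gcongr

lemma norm_stableSymbol_le {r : ℝ} (hr : 0 < r) (hr1 : r ≤ 1) (x : ℝ) :
    ‖stableSymbol r x‖ ≤ stableSymbolConst r * |x| ^ r := by
  simpa [stableSymbol_zero hr] using norm_stableSymbol_sub_le hr.le hr1 x 0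

lemma measurable_stableSymbol (r : ℝ) : Measurable (stableSymbol r) := by
  unfold stableSymbol
  fun_prop

lemma stableExponent_eq_stableSymbol {r : ℝ} (hr : 0 < r) (hr1 : r ≠ 1) (σ z : ℝ) :
    stableExponent r σ 1 0 z = -((σ ^ r : ℝ) : ℂ) * stableSymbol r z := by
  rw [stableExponent, if_neg hr1, stableSymbol]
  rcases lt_trichotomy z 0 with h | h | h
  · rw [max_eq_left h.le, max_eq_right (neg_nonneg.2 h.le), abs_of_neg h, sign_neg h,
      Real.zero_rpow hr.ne']
    push_cast; simp; ring
  · subst h; simp [Real.zero_rpow hr.ne']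
  · rw [max_eq_right h.le, max_eq_left (neg_nonpos.2 h.le), abs_of_pos h, sign_pos h,
      Real.zero_rpow hr.ne']
    push_cast; simp; ring

/-! ### Step functions -/

/-- The value of the elementary integral of a step function for a deterministic integrator. -/
noncomputable def StepFunction.apply {T : ℝ} (φ : StepFunction T) (l : ℝ≥0 → ℝ) : ℝ :=
  ∑ i ∈ Finset.range φ.n, φ.c i * (l (φ.t (i + 1)) - l (φ.t i))

lemma StepFunction.integral_eq_apply {T : ℝ} (φ : StepFunction T) {Ω : Type*}
    (L : ℝ≥0 → Ω → ℝ) (ω : Ω) : φ.integral L ω = φ.apply (fun t => L t ω) := rfl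

/-- The indicator of (a, b] at s is an increment of t ↦ 1_{s ≤ t}. Thus evaluation and stochastic
integration are the same functional for different integrators, and identities valid for every
integrator serve both. -/
lemma StepFunction.eval_eq_apply {T : ℝ} (φ : StepFunction T) (s : ℝ) :
    φ.eval s = φ.apply (fun t => if s ≤ t then 1 else 0) := by
  refine Finset.sum_congr rfl fun i _ => ?_
  have h : (φ.t i : ℝ) ≤ φ.t (i + 1) := NNReal.coe_le_coe.2 (φ.mono (Nat.le_succ i))
  congr 1
  simp only [Set.indicator, Set.mem_Ioc]
  split_ifs <;> grind

/-- Finitely many points can be listed in increasing order. -/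
lemma exists_monotone_enum (S : Finset ℝ≥0) {T : ℝ} (hT : ∀ x ∈ S, (x : ℝ) ≤ T) (hT0 : 0 ≤ T) :
    ∃ (n : ℕ) (t : ℕ → ℝ≥0), Monotone t ∧ (t n : ℝ) ≤ T ∧ ∀ x ∈ S, ∃ k ≤ n, t k = x := by
  induction S using Finset.induction_on_max with
  | empty => exact ⟨0, fun _ => 0, monotone_const, by simpa using hT0, by simp⟩
  | insert a s has ih =>
    obtain ⟨n, t, ht, _, hx⟩ := ih fun x hx => hT x (Finset.mem_insert_of_mem hx)
    -- The old sequence may take values beyond its listed points; capping at the new maximum `a`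
    -- restores monotonicity and leaves the points of `s` unchanged.
    refine ⟨n + 1, fun k => if k ≤ n then min (t k) a else a, ?_, ?_, ?_⟩
    · intro i j hij
      dsimp only
      split_ifs with h1 h2
      · exact min_le_min_right _ (ht hij)
      · exact min_le_right _ _
      · omega
      · exact le_rfl
    · simpa using hT a (Finset.mem_insert_self _ _)
    · intro x hxs
      rcases Finset.mem_insert.1 hxs with rfl | hxs
      · exact ⟨n + 1, le_rfl, by simp⟩
      · obtain ⟨k, hk, rfl⟩ := hx x hxs
        exact ⟨k, by omega, by simp [hk, (has _ hxs).le]⟩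

lemma sub_eq_sum_indicator {n k m : ℕ} (hkm : k ≤ m) (hm : m ≤ n) (f : ℕ → ℝ) :
    f m - f k = ∑ j ∈ Finset.range n, (if k ≤ j ∧ j < m then 1 else 0) * (f (j + 1) - f j) := by
  rw [← Finset.sum_Ico_sub f hkm]
  simp only [ite_mul, one_mul, zero_mul]
  rw [← Finset.sum_filter]
  refine Finset.sum_congr ?_ fun _ _ => rfl
  ext j; simp; omega

/-- Each increment telescopes over the finer grid. The coefficients are chosen before the integrator
`l`, so that one refinement works for evaluation and for every path. -/
lemma StepFunction.exists_refinement {T : ℝ} (φ : StepFunction T) {n : ℕ} {t : ℕ → ℝ≥0}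
    (ht : Monotone t) (h : ∀ i ≤ φ.n, ∃ k ≤ n, t k = φ.t i) :
    ∃ c : ℕ → ℝ, ∀ l : ℝ≥0 → ℝ,
      φ.apply l = ∑ j ∈ Finset.range n, c j * (l (t (j + 1)) - l (t j)) := by
  have h' : ∀ i, ∃ k, i ≤ φ.n → k ≤ n ∧ t k = φ.t i := fun i => by
    by_cases hi : i ≤ φ.n
    · obtain ⟨k, hk⟩ := h i hi; exact ⟨k, fun _ => hk⟩
    · exact ⟨0, fun h => absurd h hi⟩
  choose k hk using h'
  refine ⟨fun j => ∑ i ∈ Finset.range φ.n,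
    φ.c i * (if k i ≤ j ∧ j < k (i + 1) then 1 else 0), fun l => ?_⟩
  have h1 : ∀ i ∈ Finset.range φ.n, φ.c i * (l (φ.t (i + 1)) - l (φ.t i)) =
      ∑ j ∈ Finset.range n, φ.c i * (if k i ≤ j ∧ j < k (i + 1) then 1 else 0) *
        (l (t (j + 1)) - l (t j)) := by
    intro i hi
    have hi' := Finset.mem_range.1 hi
    obtain ⟨ha, ha'⟩ := hk i hi'.le
    obtain ⟨hb, hb'⟩ := hk (i + 1) hi'
    rw [← ha', ← hb']
    rcases le_or_gt (k i) (k (i + 1)) with hle | hlt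
    · rw [sub_eq_sum_indicator hle hb (fun j => l (t j)), Finset.mul_sum]
      exact Finset.sum_congr rfl fun j _ => by ring
    -- The chosen indices can be out of order only when the two nodes coincide, and then both sides
    -- vanish.
    · have e : t (k (i + 1)) = t (k i) :=
        le_antisymm (ht hlt.le) (by rw [ha', hb']; exact φ.mono (Nat.le_succ i))
      rw [e, sub_self, mul_zero, eq_comm]
      refine Finset.sum_eq_zero fun j _ => ?_
      rw [if_neg (by omega)]; ring
  rw [StepFunction.apply, Finset.sum_congr rfl h1, Finset.sum_comm]
  exact Finset.sum_congr rfl fun j _ => by rw [Finset.sum_mul]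

lemma StepFunction.exists_sub {T : ℝ} (φ ψ : StepFunction T) :
    ∃ χ : StepFunction T, ∀ l : ℝ≥0 → ℝ, χ.apply l = φ.apply l - ψ.apply l := by
  obtain ⟨n, t, ht, hT, hx⟩ := exists_monotone_enum (T := T)
    ((Finset.range (φ.n + 1)).image φ.t ∪ (Finset.range (ψ.n + 1)).image ψ.t) (by
      intro x hx
      simp only [Finset.mem_union, Finset.mem_image, Finset.mem_range] at hx
      rcases hx with ⟨i, hi, rfl⟩ | ⟨i, hi, rfl⟩
      · exact (NNReal.coe_le_coe.2 (φ.mono (by omega))).trans φ.le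
      · exact (NNReal.coe_le_coe.2 (ψ.mono (by omega))).trans ψ.le)
    ((φ.t φ.n).2.trans φ.le)
  obtain ⟨c, hc⟩ := φ.exists_refinement ht (n := n) fun i hi => hx _ (by
    simp only [Finset.mem_union, Finset.mem_image, Finset.mem_range]
    exact Or.inl ⟨i, by omega, rfl⟩)
  obtain ⟨d, hd⟩ := ψ.exists_refinement ht (n := n) fun i hi => hx _ (by
    simp only [Finset.mem_union, Finset.mem_image, Finset.mem_range]
    exact Or.inr ⟨i, by omega, rfl⟩)
  refine ⟨⟨n, t, fun i => c i - d i, ht, hT⟩, fun l => ?_⟩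
  rw [hc, hd, ← Finset.sum_sub_distrib]
  exact Finset.sum_congr rfl fun i _ => by ring

/-- Functions vanishing at zero act termwise on step functions. -/
lemma StepFunction.map_eval {T : ℝ} (φ : StepFunction T) {F : ℝ → ℂ} (hF : F 0 = 0) (s : ℝ) :
    F (φ.eval s) = ∑ i ∈ Finset.range φ.n,
      (Set.Ioc (φ.t i : ℝ) (φ.t (i + 1) : ℝ)).indicator (fun _ => F (φ.c i)) s := by
  have hmono : Monotone fun i => (φ.t i : ℝ) := fun i j h => NNReal.coe_le_coe.2 (φ.mono h)
  by_cases h : ∃ i ∈ Finset.range φ.n, s ∈ Set.Ioc (φ.t i : ℝ) (φ.t (i + 1) : ℝ)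
  · obtain ⟨i, hi, hs⟩ := h
    have hne : ∀ j, j ≠ i → s ∉ Set.Ioc (φ.t j : ℝ) (φ.t (j + 1) : ℝ) := fun j hj hs' =>
      (hmono.pairwise_disjoint_on_Ioc_succ hj).le_bot ⟨hs', hs⟩
    rw [StepFunction.eval, Finset.sum_eq_single_of_mem i hi, Finset.sum_eq_single_of_mem i hi]
    · simp [Set.indicator_of_mem hs]
    · intro j _ hj; simp [Set.indicator_of_notMem (hne j hj)]
    · intro j _ hj; simp [Set.indicator_of_notMem (hne j hj)]
  · push Not at h
    rw [StepFunction.eval, Finset.sum_eq_zero, Finset.sum_eq_zero, hF]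
    · intro i hi; simp [Set.indicator_of_notMem (h i hi)]
    · intro i hi; simp [Set.indicator_of_notMem (h i hi)]

lemma StepFunction.measurable_eval {T : ℝ} (φ : StepFunction T) : Measurable φ.eval := by
  unfold StepFunction.eval
  refine Finset.measurable_sum _ fun i _ => Measurable.const_mul ?_ _
  exact measurable_const.indicator measurableSet_Ioc

lemma StepFunction.Ioc_subset {T : ℝ} (φ : StepFunction T) {i : ℕ} (hi : i ∈ Finset.range φ.n) :
    Set.Ioc (φ.t i : ℝ) (φ.t (i + 1) : ℝ) ⊆ Set.Ioc 0 T :=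
  Set.Ioc_subset_Ioc (φ.t i).2
    ((NNReal.coe_le_coe.2 (φ.mono (Finset.mem_range.1 hi))).trans φ.le)

lemma StepFunction.integrableOn_map_eval {T : ℝ} (φ : StepFunction T) {F : ℝ → ℂ}
    (hF : F 0 = 0) : IntegrableOn (fun s => F (φ.eval s)) (Set.Ioc 0 T) := by
  simp_rw [φ.map_eval hF]
  refine integrable_finsetSum _ fun i _ => ?_
  exact (integrable_const _).indicator measurableSet_Ioc

lemma StepFunction.integral_map_eval {T : ℝ} (φ : StepFunction T) {F : ℝ → ℂ} (hF : F 0 = 0) :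
    ∫ s in Set.Ioc 0 T, F (φ.eval s) =
      ∑ i ∈ Finset.range φ.n, ((φ.t (i + 1) - φ.t i : ℝ) : ℂ) * F (φ.c i) := by
  simp_rw [φ.map_eval hF]
  rw [integral_finsetSum _ fun i _ => (integrable_const _).indicator measurableSet_Ioc]
  refine Finset.sum_congr rfl fun i hi => ?_
  rw [setIntegral_indicator measurableSet_Ioc, Set.inter_eq_right.2 (φ.Ioc_subset hi),
    setIntegral_const, Real.volume_real_Ioc_of_le
      (NNReal.coe_le_coe.2 (φ.mono (Nat.le_succ i))), Complex.real_smul]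

/-! ### Elementary stable integrals -/

section Integral

variable {Ω : Type*} [MeasurableSpace Ω] {P : Measure Ω} {L : ℝ≥0 → Ω → ℝ} {r τ T : ℝ}

lemma StepFunction.aemeasurable_integral (φ : StepFunction T) (hL : IsLevyProcess L P) :
    AEMeasurable (φ.integral L) P := by
  unfold StepFunction.integral
  exact Finset.aemeasurable_fun_sum _ fun i _ =>
    ((hL.aemeasurable _).sub (hL.aemeasurable _)).const_mul _

/-- The r-th power of the scale τ(t - s)^{1/r} is linear in t - s, which is why sums over steps
become integrals. Empty increments are included because step functions may repeat nodes. -/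
lemma IsStableLevyProcess.charFun_increment [IsProbabilityMeasure P]
    (hL : IsStableLevyProcess L P r τ 1) (hr1 : r < 1) {s t : ℝ≥0} (hst : s ≤ t) (z : ℝ) :
    charFun (P.map fun ω => L t ω - L s ω) z =
      Complex.exp (-((τ ^ r : ℝ) : ℂ) * (((t - s : ℝ) : ℂ) * stableSymbol r z)) := by
  rcases hst.eq_or_lt with rfl | hst
  · simp [Measure.map_const]
  · have h := hL.increment s t hst
    have hts : (0 : ℝ) < t - s := sub_pos.2 (NNReal.coe_lt_coe.2 hst)
    have hr := h.index_mem.1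
    have hp : (0 : ℝ) < ((t : ℝ) - s) ^ (1 / r) := Real.rpow_pos_of_pos hts _
    have hτ : 0 < τ := pos_of_mul_pos_left h.scale_pos hp.le
    rw [h.charFun_eq, stableExponent_eq_stableSymbol hr hr1.ne, Real.mul_rpow hτ.le hp.le,
      ← Real.rpow_mul hts.le, one_div, inv_mul_cancel₀ hr.ne', Real.rpow_one]
    push_cast; ring_nf

lemma StepFunction.charFun_integral [IsProbabilityMeasure P] (φ : StepFunction T)
    (hL : IsStableLevyProcess L P r τ 1) (hr : 0 < r) (hr1 : r < 1) (z : ℝ) :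
    charFun (P.map (φ.integral L)) z =
      Complex.exp (-((τ ^ r : ℝ) : ℂ) * ∫ s in Set.Ioc 0 T, stableSymbol r (z * φ.eval s)) := by
  have hm : ∀ i : Fin φ.n, AEMeasurable
      (fun ω => φ.c i * (L (φ.t (i + 1)) ω - L (φ.t i) ω)) P := fun i =>
    ((hL.aemeasurable _).sub (hL.aemeasurable _)).const_mul _
  have hind : iIndepFun (fun (i : Fin φ.n) ω => φ.c i * (L (φ.t (i + 1)) ω - L (φ.t i) ω)) P := by
    have h := hL.indep φ.n (fun i => φ.t i) fun i j hij => φ.mono hij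
    exact h.comp (fun i x => φ.c i * x) fun i => measurable_const_mul _
  have e : φ.integral L = fun ω => ∑ i : Fin φ.n,
      φ.c i * (L (φ.t (i + 1)) ω - L (φ.t i) ω) := by
    ext ω
    rw [StepFunction.integral, ← Fin.sum_univ_eq_sum_range
      (fun i => φ.c i * (L (φ.t (i + 1)) ω - L (φ.t i) ω))]
  rw [e, hind.charFun_map_fun_sum_eq_prod hm,
    φ.integral_map_eval (F := fun x => stableSymbol r (z * x)) (by simp [stableSymbol_zero hr]),
    Finset.mul_sum, Complex.exp_sum, ← Fin.prod_univ_eq_prod_range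
      (fun i : ℕ => Complex.exp (-((τ ^ r : ℝ) : ℂ) *
        (((φ.t (i + 1) - φ.t i : ℝ) : ℂ) * stableSymbol r (z * φ.c i)))) φ.n]
  rw [Finset.prod_apply]
  refine Finset.prod_congr rfl fun i _ => ?_
  have hd : AEMeasurable (fun ω => L (φ.t (i + 1)) ω - L (φ.t i) ω) P :=
    (hL.aemeasurable _).sub (hL.aemeasurable _)
  rw [charFun_map_mul_comp hd,
    hL.charFun_increment hr1 (φ.mono (Nat.le_succ i)), mul_comm z]

end Integral

end StableCarma

namespace StableCarma

section StableIntegral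

variable {Ω : Type*} [MeasurableSpace Ω] {P : Measure Ω} {L : ℝ≥0 → Ω → ℝ} {r τ T : ℝ}

/-! ### Limits of elementary stable integrals -/

lemma enorm_stableSymbol_sub_le (hr : 0 < r) (hr1 : r < 1) (z x y : ℝ) :
    ‖stableSymbol r (z * x) - stableSymbol r (z * y)‖ₑ ≤
      ENNReal.ofReal (stableSymbolConst r * |z| ^ r) * ENNReal.ofReal (|x - y| ^ r) := by
  rw [← ofReal_norm, ← ENNReal.ofReal_mul
    (mul_nonneg (stableSymbolConst_nonneg r) (Real.rpow_nonneg (abs_nonneg z) r))]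
  refine ENNReal.ofReal_le_ofReal ((norm_stableSymbol_sub_le hr.le hr1.le _ _).trans_eq ?_)
  rw [← mul_sub, abs_mul, Real.mul_rpow (abs_nonneg _) (abs_nonneg _), mul_assoc]

lemma tendsto_integral_stableSymbol (hr : 0 < r) (hr1 : r < 1) {φ : ℕ → StepFunction T}
    {f : ℝ → ℝ} (hf : AEMeasurable f (volume.restrict (Set.Ioc 0 T)))
    (h : Tendsto (fun k => ∫⁻ s in Set.Ioc 0 T, ENNReal.ofReal (|(φ k).eval s - f s| ^ r))
      atTop (𝓝 0)) (z : ℝ) :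
    Tendsto (fun k => ∫ s in Set.Ioc 0 T, stableSymbol r (z * (φ k).eval s)) atTop
      (𝓝 (∫ s in Set.Ioc 0 T, stableSymbol r (z * f s))) := by
  have hfm : AEStronglyMeasurable (fun s => stableSymbol r (z * f s))
      (volume.restrict (Set.Ioc 0 T)) :=
    ((measurable_stableSymbol r).comp_aemeasurable (hf.const_mul z)).aestronglyMeasurable
  have hφ : ∀ k, IntegrableOn (fun s => stableSymbol r (z * (φ k).eval s)) (Set.Ioc 0 T) :=
    fun k => (φ k).integrableOn_map_eval (F := fun x => stableSymbol r (z * x))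
      (by simp [stableSymbol_zero hr])
  have hle : ∀ k, ∫⁻ s in Set.Ioc 0 T,
      ‖stableSymbol r (z * (φ k).eval s) - stableSymbol r (z * f s)‖ₑ ≤
      ENNReal.ofReal (stableSymbolConst r * |z| ^ r) *
        ∫⁻ s in Set.Ioc 0 T, ENNReal.ofReal (|(φ k).eval s - f s| ^ r) := fun k => by
    rw [← lintegral_const_mul' _ _ ENNReal.ofReal_ne_top]
    exact lintegral_mono fun s => enorm_stableSymbol_sub_le hr hr1 z _ _
  -- Integrability of the limit symbol comes from a single step function at finite distance from
  -- `f`.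
  obtain ⟨k, hk⟩ := (h.eventually (gt_mem_nhds ENNReal.zero_lt_top)).exists
  have hfi : IntegrableOn (fun s => stableSymbol r (z * f s)) (Set.Ioc 0 T) := by
    have hd : IntegrableOn
        (fun s => stableSymbol r (z * (φ k).eval s) - stableSymbol r (z * f s)) (Set.Ioc 0 T) :=
      ⟨(hφ k).aestronglyMeasurable.sub hfm,
        (hle k).trans_lt (ENNReal.mul_lt_top ENNReal.ofReal_lt_top hk)⟩
    exact ((hφ k).sub hd).congr_fun (fun s _ => sub_sub_cancel _ _) measurableSet_Ioc
  refine tendsto_integral_of_L1 _ hfi.aestronglyMeasurable (Eventually.of_forall hφ) ?_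
  refine tendsto_of_tendsto_of_tendsto_of_le_of_le tendsto_const_nhds ?_
    (fun _ => zero_le) hle
  simpa using ENNReal.Tendsto.const_mul h (Or.inr ENNReal.ofReal_ne_top)

/-- Convergence in probability implies convergence of the characteristic functions along a
subsequence. -/
lemma exists_seq_tendsto_charFun [IsProbabilityMeasure P] {X : ℕ → Ω → ℝ} {Y : Ω → ℝ}
    (hX : ∀ k, AEMeasurable (X k) P) (hY : AEMeasurable Y P)
    (h : TendstoInMeasure P X atTop Y) :
    ∃ ns : ℕ → ℕ, StrictMono ns ∧ ∀ z : ℝ,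
      Tendsto (fun k => charFun (P.map (X (ns k))) z) atTop (𝓝 (charFun (P.map Y) z)) := by
  obtain ⟨ns, hns, hae⟩ := h.exists_seq_tendsto_ae
  refine ⟨ns, hns, fun z => ?_⟩
  have hc : Continuous fun x : ℝ => Complex.exp (z * x * Complex.I) := by fun_prop
  have e : ∀ {V : Ω → ℝ}, AEMeasurable V P →
      charFun (P.map V) z = ∫ ω, Complex.exp (z * V ω * Complex.I) ∂P := fun {V} hV => by
    rw [charFun_apply_real, integral_map hV hc.aestronglyMeasurable]
  rw [e hY]
  simp_rw [fun k => e (hX (ns k))]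
  refine tendsto_integral_of_dominated_convergence (fun _ => 1)
    (fun k => (hc.measurable.comp_aemeasurable (hX _)).aestronglyMeasurable)
    (integrable_const _) (fun k => Eventually.of_forall fun ω => ?_) ?_
  · have := Complex.norm_exp_ofReal_mul_I (z * X (ns k) ω)
    push_cast at this
    exact this.le
  · filter_upwards [hae] with ω hω
    exact (hc.tendsto _).comp hω

/-- The exponents converge along the whole sequence, so a subsequence of characteristic functions
suffices to identify the limit. The answer involves only `f`, so all versions have the same law. -/
lemma IsStableIntegral.charFun_eq [IsProbabilityMeasure P]
    (hL : IsStableLevyProcess L P r τ 1) (hr : 0 < r) (hr1 : r < 1) {f : ℝ → ℝ} {J : Ω → ℝ}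
    (h : IsStableIntegral L P r T f J) (z : ℝ) :
    charFun (P.map J) z =
      Complex.exp (-((τ ^ r : ℝ) : ℂ) * ∫ s in Set.Ioc 0 T, stableSymbol r (z * f s)) := by
  obtain ⟨hf, hJ, φ, hφ, hφJ⟩ := h
  obtain ⟨ns, hns, hlim⟩ := exists_seq_tendsto_charFun
    (fun k => (φ k).aemeasurable_integral hL.toIsLevyProcess) hJ hφJ
  refine tendsto_nhds_unique (hlim z) ?_
  simp_rw [fun k => (φ (ns k)).charFun_integral hL hr hr1 z]
  exact (Complex.continuous_exp.tendsto _).comp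
    (((tendsto_integral_stableSymbol hr hr1 hf hφ z).comp hns.tendsto_atTop).const_mul _)

lemma tendstoInMeasure_sub {X X' : ℕ → Ω → ℝ} {Y Y' : Ω → ℝ}
    (h : TendstoInMeasure P X atTop Y) (h' : TendstoInMeasure P X' atTop Y') :
    TendstoInMeasure P (fun k ω => X k ω - X' k ω) atTop (fun ω => Y ω - Y' ω) := by
  rw [tendstoInMeasure_iff_norm] at h h' ⊢
  intro ε hε
  refine tendsto_of_tendsto_of_tendsto_of_le_of_le tendsto_const_nhds
    (by simpa using (h (ε / 2) (half_pos hε)).add (h' (ε / 2) (half_pos hε)))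
    (fun _ => zero_le) fun k => (measure_mono ?_).trans (measure_union_le _ _)
  intro ω hω
  simp only [Set.mem_ofPred_eq, Set.mem_union, Real.norm_eq_abs] at hω ⊢
  by_contra! hcon
  have := abs_sub (X k ω - Y ω) (X' k ω - Y' ω)
  rw [show X k ω - Y ω - (X' k ω - Y' ω) = X k ω - X' k ω - (Y ω - Y' ω) by ring] at this
  linarith

/-- For r < 1 the quantity ∫ |f|^r is itself subadditive; differences of step functions are formed
on a common grid. -/
lemma IsStableIntegral.sub (hr : 0 < r) (hr1 : r < 1) {f f' : ℝ → ℝ}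
    {J J' : Ω → ℝ} (h : IsStableIntegral L P r T f J) (h' : IsStableIntegral L P r T f' J') :
    IsStableIntegral L P r T (fun s => f s - f' s) (fun ω => J ω - J' ω) := by
  obtain ⟨hf, hJ, φ, hφ, hφJ⟩ := h
  obtain ⟨hf', hJ', φ', hφ', hφJ'⟩ := h'
  choose χ hχ using fun k => (φ k).exists_sub (φ' k)
  refine ⟨hf.sub hf', hJ.sub hJ', χ, ?_, ?_⟩
  · refine tendsto_of_tendsto_of_tendsto_of_le_of_le tendsto_const_nhds
      (by simpa using hφ.add hφ') (fun _ => zero_le) fun k => ?_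
    have hm : AEMeasurable (fun s => ENNReal.ofReal (|(φ k).eval s - f s| ^ r))
        (volume.restrict (Set.Ioc 0 T)) :=
      ENNReal.measurable_ofReal.comp_aemeasurable
        (((continuous_abs.measurable.comp_aemeasurable
          ((φ k).measurable_eval.aemeasurable.sub hf))).pow_const r)
    dsimp only
    rw [← lintegral_add_left' hm]
    refine lintegral_mono fun s => ?_
    rw [← ENNReal.ofReal_add (Real.rpow_nonneg (abs_nonneg _) _)
      (Real.rpow_nonneg (abs_nonneg _) _)]
    refine ENNReal.ofReal_le_ofReal (le_trans (Real.rpow_le_rpow (abs_nonneg _) ?_ hr.le)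
      (Real.rpow_add_le_add_rpow (abs_nonneg _) (abs_nonneg _) hr.le hr1.le))
    rw [StepFunction.eval_eq_apply, hχ, ← StepFunction.eval_eq_apply,
      ← StepFunction.eval_eq_apply]
    have := abs_sub ((φ k).eval s - f s) ((φ' k).eval s - f' s)
    rwa [show (φ k).eval s - f s - ((φ' k).eval s - f' s) =
      (φ k).eval s - (φ' k).eval s - (f s - f' s) by ring] at this
  · refine (tendstoInMeasure_sub hφJ hφJ').congr_left fun k => Eventually.of_forall fun ω => ?_
    simp only [StepFunction.integral_eq_apply, hχ]

/-! ### Existence of stable integrals of continuous functions -/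

/-- Elementary integrals of uniformly small step functions are small in probability. -/
lemma exists_pos_measure_integral_gt_le [IsProbabilityMeasure P]
    (hL : IsStableLevyProcess L P r τ 1) (hr : 0 < r) (hr1 : r < 1) (hT : 0 ≤ T) {ε : ℝ}
    (hε : 0 < ε) :
    ∃ δ > 0, ∀ χ : StepFunction T, (∀ s ∈ Set.Ioc 0 T, |χ.eval s| ≤ δ) →
      P.real {ω | ε < |χ.integral L ω|} ≤ ε := by
  set D : ℝ := |τ ^ r| * (T * stableSymbolConst r) with hD
  have hlim : Tendsto (fun δ : ℝ => D * (2 * ε⁻¹ * δ) ^ r) (𝓝[>] 0) (𝓝 0) := by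
    have : Tendsto (fun δ : ℝ => D * (2 * ε⁻¹ * δ) ^ r) (𝓝 0) (𝓝 (D * (2 * ε⁻¹ * 0) ^ r)) := by
      refine ContinuousAt.tendsto (f := fun δ : ℝ => D * (2 * ε⁻¹ * δ) ^ r) ?_
      exact continuousAt_const.mul
        ((continuousAt_const.mul continuousAt_id).rpow_const (Or.inr hr.le))
    simp only [mul_zero, Real.zero_rpow hr.ne'] at this
    exact this.mono_left nhdsWithin_le_nhds
  -- The bound 1 on the exponent w allows |exp w - 1| ≤ 2|w|, and ε/4 makes this at most ε/2. The
  -- tail inequality integrates over length 4/ε with prefactor ε/2, giving exactly ε.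
  obtain ⟨δ, hδ, hδ0⟩ := ((hlim.eventually (gt_mem_nhds (show 0 < min 1 (ε / 4) by positivity))).and
    self_mem_nhdsWithin).exists
  have hδ0 : 0 < δ := hδ0
  refine ⟨δ, hδ0, fun χ hχ => ?_⟩
  have hXm := χ.aemeasurable_integral hL.toIsLevyProcess
  have := Measure.isProbabilityMeasure_map (μ := P) hXm
  have hset : P.real {ω | ε < |χ.integral L ω|} =
      (P.map (χ.integral L)).real {x | ε < |x|} := by
    rw [Measure.real, Measure.real, Measure.map_apply_of_aemeasurable hXm
      (measurableSet_lt measurable_const continuous_abs.measurable)]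
    rfl
  rw [hset]
  refine measureReal_abs_gt_le_integral_charFun hε |>.trans ?_
  have hb : ∀ t ∈ Set.uIoc (-2 * ε⁻¹) (2 * ε⁻¹),
      ‖1 - charFun (P.map (χ.integral L)) t‖ ≤ ε / 2 := by
    intro t ht
    have hεi : 0 < ε⁻¹ := inv_pos.2 hε
    have ht' : |t| ≤ 2 * ε⁻¹ := by
      rw [Set.uIoc_of_le (by linarith)] at ht
      exact abs_le.2 ⟨by linarith [ht.1], ht.2⟩
    rw [χ.charFun_integral hL hr hr1, norm_sub_rev]
    have hw : ‖-((τ ^ r : ℝ) : ℂ) * ∫ s in Set.Ioc 0 T, stableSymbol r (t * χ.eval s)‖ ≤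
        D * (2 * ε⁻¹ * δ) ^ r := by
      rw [norm_mul, norm_neg, Complex.norm_real, Real.norm_eq_abs, hD, mul_assoc]
      refine mul_le_mul_of_nonneg_left ?_ (abs_nonneg _)
      refine (norm_setIntegral_le_of_norm_le_const (C := stableSymbolConst r * (2 * ε⁻¹ * δ) ^ r)
        (by simp) fun s hs => ?_).trans_eq ?_
      · refine (norm_stableSymbol_le hr hr1.le _).trans
          (mul_le_mul_of_nonneg_left ?_ (stableSymbolConst_nonneg r))
        refine Real.rpow_le_rpow (abs_nonneg _) ?_ hr.le
        rw [abs_mul]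
        exact mul_le_mul ht' (hχ s hs) (abs_nonneg _) (by positivity)
      · rw [Real.volume_real_Ioc_of_le hT]; ring
    have hw1 := hw.trans hδ.le
    refine (Complex.norm_exp_sub_one_le (hw1.trans (min_le_left _ _))).trans ?_
    linarith [hw1.trans (min_le_right _ _)]
  have hI := intervalIntegral.norm_integral_le_of_norm_le_const hb
  calc 2⁻¹ * ε * _ ≤ 2⁻¹ * ε * (ε / 2 * |2 * ε⁻¹ - -2 * ε⁻¹|) := by gcongr
    _ = ε := by
      rw [show 2 * ε⁻¹ - -2 * ε⁻¹ = 4 * ε⁻¹ by ring, abs_of_pos (by positivity)]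
      field_simp; norm_num

/-- Sequences that are Cauchy in probability have subsequences converging in probability. -/
lemma exists_tendstoInMeasure_of_cauchy [IsProbabilityMeasure P] {X : ℕ → Ω → ℝ}
    (hX : ∀ k, AEMeasurable (X k) P)
    (hC : ∀ ε > 0, ∃ N, ∀ m ≥ N, ∀ n ≥ N, P.real {ω | ε < |X m ω - X n ω|} ≤ ε) :
    ∃ (ns : ℕ → ℕ) (Y : Ω → ℝ), StrictMono ns ∧ AEMeasurable Y P ∧
      TendstoInMeasure P (fun k => X (ns k)) atTop Y := by
  have hpos : ∀ k : ℕ, (0 : ℝ) < (1 / 2) ^ k := fun k => by positivity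
  -- Along this subsequence consecutive differences exceed 2^{-k} with probability at most 2^{-k};
  -- Borel–Cantelli then gives almost sure convergence.
  obtain ⟨ns, hns, hN⟩ := extraction_forall_of_eventually'
    (P := fun k n => ∀ m ≥ n, P.real {ω | (1 / 2 : ℝ) ^ k < |X m ω - X n ω|} ≤ (1 / 2) ^ k)
    fun k => by
      obtain ⟨N, hN⟩ := hC _ (hpos k)
      exact ⟨N, fun n hn m hm => hN m (le_trans hn hm) n hn⟩
  have hsum : ∑' k, P {ω | (1 / 2 : ℝ) ^ k < |X (ns (k + 1)) ω - X (ns k) ω|} ≠ ⊤ := by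
    refine ne_top_of_le_ne_top (summable_geometric_two.tsum_ofReal_ne_top)
      (ENNReal.tsum_le_tsum fun k => ?_)
    rw [← ofReal_measureReal (measure_ne_top _ _)]
    exact ENNReal.ofReal_le_ofReal (hN k _ (hns.monotone (Nat.le_succ k)))
  have hae : ∀ᵐ ω ∂P, ∃ l, Tendsto (fun k => X (ns k) ω) atTop (𝓝 l) := by
    filter_upwards [ae_eventually_notMem hsum] with ω hω
    refine cauchySeq_tendsto_of_complete (cauchySeq_of_summable_dist ?_)
    refine Summable.of_norm_bounded_eventually_nat summable_geometric_two ?_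
    filter_upwards [hω] with k hk
    rw [Real.norm_eq_abs, abs_of_nonneg dist_nonneg, dist_comm, Real.dist_eq]
    exact not_lt.1 hk
  obtain ⟨Y, hY, hlim⟩ := measurable_limit_of_tendsto_metrizable_ae (fun k => hX (ns k)) hae
  exact ⟨ns, Y, hns, hY.aemeasurable,
    tendstoInMeasure_of_tendsto_ae (fun k => (hX _).aestronglyMeasurable) hlim⟩

/-- Continuous functions are uniform limits of step functions. -/
lemma exists_stepFunction_approx (hT : 0 ≤ T) {f : ℝ → ℝ} (hf : Continuous f) {ε : ℝ}
    (hε : 0 < ε) :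
    ∃ φ : StepFunction T, ∀ s ∈ Set.Ioc 0 T, |φ.eval s - f s| ≤ ε := by
  have huc := (isCompact_Icc (a := (0 : ℝ)) (b := T)).uniformContinuousOn_of_continuous
    hf.continuousOn
  obtain ⟨δ, hδ, h⟩ := Metric.uniformContinuousOn_iff.1 huc ε hε
  obtain ⟨n, hn⟩ := exists_nat_gt (T / δ)
  have hn0 : (0 : ℝ) < n := lt_of_le_of_lt (by positivity) hn
  have hTn : T / n < δ := by
    rw [div_lt_iff₀ hδ] at hn; rw [div_lt_iff₀ hn0]; linarith
  let t : ℕ → ℝ≥0 := fun i => Real.toNNReal (T / n * i)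
  have ht : ∀ i, (t i : ℝ) = T / n * i := fun i => Real.coe_toNNReal _ (by positivity)
  have hmono : Monotone t := fun i j hij => by
    rw [← NNReal.coe_le_coe, ht, ht]; gcongr
  let φ : StepFunction T := ⟨n, t, fun i => f (t (i + 1)), hmono, by
    rw [ht]; exact (div_mul_cancel₀ T hn0.ne').le⟩
  refine ⟨φ, fun s hs => ?_⟩
  have hTpos : 0 < T := hs.1.trans_le hs.2
  have hTn0 : 0 < T / n := by positivity
  -- The cells are open on the left, so the index is a ceiling minus one.
  obtain ⟨i, hi, his⟩ : ∃ i < n, s ∈ Set.Ioc (t i : ℝ) (t (i + 1) : ℝ) := by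
    have hc0 : 0 < ⌈s / (T / n)⌉₊ := Nat.ceil_pos.2 (by have := hs.1; positivity)
    have hcn : ⌈s / (T / n)⌉₊ ≤ n := Nat.ceil_le.2 (by
      rw [div_le_iff₀ hTn0]
      calc s ≤ T := hs.2
        _ = n * (T / n) := by field_simp)
    refine ⟨⌈s / (T / n)⌉₊ - 1, by omega, ?_⟩
    rw [Nat.sub_add_cancel hc0, Set.mem_Ioc, ht, ht]
    constructor
    · have := Nat.lt_ceil.1 (Nat.sub_lt hc0 one_pos)
      rwa [lt_div_iff₀ hTn0, mul_comm] at this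
    · have := Nat.le_ceil (s / (T / n))
      rwa [div_le_iff₀ hTn0, mul_comm] at this
  have hmono' : Monotone fun i => (t i : ℝ) := fun i j h => NNReal.coe_le_coe.2 (hmono h)
  have heval : φ.eval s = f (t (i + 1)) := by
    rw [StepFunction.eval, Finset.sum_eq_single_of_mem i (Finset.mem_range.2 hi)]
    · rw [Set.indicator_of_mem his, mul_one]
    · intro j _ hj
      rw [Set.indicator_of_notMem, mul_zero]
      exact fun hs' => (hmono'.pairwise_disjoint_on_Ioc_succ hj).le_bot ⟨hs', his⟩
  rw [heval, ← Real.dist_eq]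
  refine (h (t (i + 1) : ℝ) ⟨NNReal.coe_nonneg _, ?_⟩ s ⟨hs.1.le, hs.2⟩ ?_).le
  · exact (NNReal.coe_le_coe.2 (hmono (Nat.succ_le_of_lt hi))).trans φ.le
  · have h2 := his.1
    have h3 := his.2
    rw [ht] at h2
    rw [Real.dist_eq, abs_of_nonneg (by linarith), ht]
    push_cast at *
    linarith [mul_add (T / n) i 1]

/-- Functions that are continuous on `[0, T]` have stable integrals. -/
lemma exists_isStableIntegral [IsProbabilityMeasure P]
    (hL : IsStableLevyProcess L P r τ 1) (hr : 0 < r) (hr1 : r < 1) (hT : 0 ≤ T)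
    {f g : ℝ → ℝ} (hg : Continuous g) (hfg : Set.EqOn f g (Set.Ioc 0 T)) :
    ∃ J : Ω → ℝ, IsStableIntegral L P r T f J := by
  have hpos : ∀ k : ℕ, (0 : ℝ) < 1 / (k + 1) := fun k => by positivity
  choose φ hφ using fun k : ℕ => exists_stepFunction_approx hT hg (hpos k)
  have hm := fun k => (φ k).aemeasurable_integral hL.toIsLevyProcess
  obtain ⟨ns, J, hns, hJ, hlim⟩ := exists_tendstoInMeasure_of_cauchy hm (fun ε hε => by
    obtain ⟨δ, hδ, h⟩ := exists_pos_measure_integral_gt_le hL hr hr1 hT hε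
    -- Two approximations within δ/2 of `g` differ by at most δ, the threshold for small integrals.
    obtain ⟨N, hN⟩ := exists_nat_one_div_lt (half_pos hδ)
    refine ⟨N, fun m hm n hn => ?_⟩
    obtain ⟨χ, hχ⟩ := (φ m).exists_sub (φ n)
    have h1 := h χ fun s hs => by
      rw [StepFunction.eval_eq_apply, hχ, ← StepFunction.eval_eq_apply,
        ← StepFunction.eval_eq_apply]
      have h2 := hφ m s hs
      have h3 := hφ n s hs
      have h4 := abs_sub ((φ m).eval s - g s) ((φ n).eval s - g s)
      rw [sub_sub_sub_cancel_right] at h4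
      have h5 := Nat.one_div_le_one_div (α := ℝ) hm
      have h6 := Nat.one_div_le_one_div (α := ℝ) hn
      linarith
    simpa only [StepFunction.integral_eq_apply, hχ] using h1)
  refine ⟨J, ?_, hJ, fun k => φ (ns k), ?_, hlim⟩
  · refine hg.aemeasurable.congr ?_
    filter_upwards [ae_restrict_mem measurableSet_Ioc] with s hs using (hfg hs).symm
  · have hb : ∀ k, ∫⁻ s in Set.Ioc 0 T, ENNReal.ofReal (|(φ (ns k)).eval s - f s| ^ r) ≤
        ENNReal.ofReal ((1 / ((ns k : ℝ) + 1)) ^ r) * ENNReal.ofReal T := fun k => by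
      refine (setLIntegral_mono measurable_const fun s hs => ENNReal.ofReal_le_ofReal
        (Real.rpow_le_rpow (abs_nonneg _) ?_ hr.le)).trans_eq (by
          rw [setLIntegral_const, Real.volume_Ioc, sub_zero])
      rw [hfg hs]
      exact hφ _ s hs
    refine tendsto_of_tendsto_of_tendsto_of_le_of_le tendsto_const_nhds ?_
      (fun _ => zero_le) hb
    have h1 : Tendsto (fun k => (1 / ((ns k : ℝ) + 1)) ^ r) atTop (𝓝 0) := by
      have := (tendsto_one_div_add_atTop_nhds_zero_nat (𝕜 := ℝ)).comp hns.tendsto_atTop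
      simpa [Real.zero_rpow hr.ne'] using this.rpow_const (Or.inr hr.le)
    simpa using ENNReal.Tendsto.mul_const (ENNReal.tendsto_ofReal h1)
      (Or.inr (ENNReal.ofReal_ne_top (r := T)))

end StableIntegral

end StableCarma

namespace StableCarma

/-! ### The law of a stable integral and the sign of the constants C_r -/

section Law

variable {Ω : Type*} [MeasurableSpace Ω] {P : Measure Ω} {L : ℝ≥0 → Ω → ℝ} {r τ T : ℝ}

lemma max_rpow_add_max_neg_rpow {r : ℝ} (hr : 0 < r) (x : ℝ) :
    max 0 x ^ r + max 0 (-x) ^ r = |x| ^ r := by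
  rcases le_total 0 x with h | h
  · rw [max_eq_right h, max_eq_left (neg_nonpos.2 h), abs_of_nonneg h, Real.zero_rpow hr.ne',
      add_zero]
  · rw [max_eq_left h, max_eq_right (neg_nonneg.2 h), abs_of_nonpos h, Real.zero_rpow hr.ne',
      zero_add]

/-- A negative `z` exchanges the positive and negative parts of `x`; all remaining dependence on `z`
is the factor |z|^r. Integrated over `x = f s`, this displays the scale and the skewness. -/
lemma stableSymbol_mul {r : ℝ} (hr : 0 < r) (z x : ℝ) :
    stableSymbol r (z * x) = ((|z| ^ r : ℝ) : ℂ) * (((|x| ^ r : ℝ) : ℂ) -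
      Complex.I * ((SignType.sign z * Real.tan (Real.pi * r / 2) : ℝ) : ℂ) *
        ((max 0 x ^ r - max 0 (-x) ^ r : ℝ) : ℂ)) := by
  rw [← max_rpow_add_max_neg_rpow hr x, stableSymbol]
  rcases lt_trichotomy z 0 with h | h | h
  · have h1 : max 0 (z * x) = |z| * max 0 (-x) := by
      rw [abs_of_neg h, mul_max_of_nonneg _ _ (neg_nonneg.2 h.le)]; ring_nf
    have h2 : max 0 (-(z * x)) = |z| * max 0 x := by
      rw [abs_of_neg h, mul_max_of_nonneg _ _ (neg_nonneg.2 h.le)]; ring_nf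
    rw [h1, h2, Real.mul_rpow (abs_nonneg _) (le_max_left _ _),
      Real.mul_rpow (abs_nonneg _) (le_max_left _ _), sign_neg h]
    push_cast; simp; ring
  · subst h; simp [Real.zero_rpow hr.ne']
  · have h1 : max 0 (z * x) = |z| * max 0 x := by
      rw [abs_of_pos h, mul_max_of_nonneg _ _ h.le]; ring_nf
    have h2 : max 0 (-(z * x)) = |z| * max 0 (-x) := by
      rw [abs_of_pos h, mul_max_of_nonneg _ _ h.le]; ring_nf
    rw [h1, h2, Real.mul_rpow (abs_nonneg _) (le_max_left _ _),
      Real.mul_rpow (abs_nonneg _) (le_max_left _ _), sign_pos h]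
    push_cast; simp; ring

/-- The law of a nondegenerate stable integral. -/
lemma IsStableIntegral.hasStableLaw [IsProbabilityMeasure P]
    (hL : IsStableLevyProcess L P r τ 1) (hr : 0 < r) (hr1 : r < 1) (hT : 0 ≤ T) (hτ : 0 < τ)
    {f : ℝ → ℝ} {J : Ω → ℝ} (h : IsStableIntegral L P r T f J) (κ : ℝ)
    (hpos : 0 < ∫ s in (0 : ℝ)..T, |κ * f s| ^ r) :
    HasStableLaw (fun ω => κ * J ω) P r
      ((τ ^ r * ∫ s in (0 : ℝ)..T, |κ * f s| ^ r) ^ (1 / r))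
      ((∫ s in (0 : ℝ)..T, (max 0 (κ * f s) ^ r - max 0 (-(κ * f s)) ^ r)) /
        ∫ s in (0 : ℝ)..T, |κ * f s| ^ r) 0 := by
  rw [intervalIntegral.integral_of_le hT] at hpos
  rw [intervalIntegral.integral_of_le hT, intervalIntegral.integral_of_le hT]
  set I : ℝ := ∫ s in Set.Ioc 0 T, |κ * f s| ^ r with hI
  set D : ℝ := ∫ s in Set.Ioc 0 T, (max 0 (κ * f s) ^ r - max 0 (-(κ * f s)) ^ r) with hD
  have hτr : 0 < τ ^ r := Real.rpow_pos_of_pos hτ r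
  -- A nonintegrable function has integral 0 by convention, so positivity of the integral already
  -- forces integrability.
  have hint : IntegrableOn (fun s => |κ * f s| ^ r) (Set.Ioc 0 T) := by
    by_contra hcon
    rw [hI, integral_undef hcon] at hpos
    exact lt_irrefl _ hpos
  have hle : ∀ x : ℝ, |max 0 x ^ r - max 0 (-x) ^ r| ≤ |x| ^ r := fun x => by
    rw [← max_rpow_add_max_neg_rpow hr]
    have h1 : 0 ≤ max 0 x ^ r := Real.rpow_nonneg (le_max_left _ _) _
    have h2 : 0 ≤ max 0 (-x) ^ r := Real.rpow_nonneg (le_max_left _ _) _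
    exact abs_le.2 ⟨by linarith, by linarith⟩
  have hfm : AEMeasurable (fun s => κ * f s) (volume.restrict (Set.Ioc 0 T)) := h.1.const_mul κ
  have hintD : IntegrableOn (fun s => max 0 (κ * f s) ^ r - max 0 (-(κ * f s)) ^ r)
      (Set.Ioc 0 T) := by
    refine hint.mono' ?_ (Eventually.of_forall fun s => hle _)
    exact (((aemeasurable_const.max hfm).pow_const r).sub
      ((aemeasurable_const.max hfm.neg).pow_const r)).aestronglyMeasurable
  have hDI : |D| ≤ I := by
    rw [← Real.norm_eq_abs, hD]
    exact norm_integral_le_of_norm_le hint (Eventually.of_forall fun s => hle (κ * f s))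
  refine ⟨h.2.1.const_mul κ, ⟨hr, by linarith⟩, by positivity, ?_, fun z => ?_⟩
  · rw [Set.mem_Icc, ← abs_le, abs_div, abs_of_pos hpos]
    exact div_le_one_of_le₀ hDI hpos.le
  · rw [charFun_map_mul_comp h.2.1, h.charFun_eq hL hr hr1, stableExponent, if_neg hr1.ne,
      ← Real.rpow_mul (by positivity), one_div, inv_mul_cancel₀ hr.ne', Real.rpow_one]
    congr 1
    have e : ∫ s in Set.Ioc 0 T, stableSymbol r (κ * z * f s) =
        ((|z| ^ r : ℝ) : ℂ) * ((I : ℂ) -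
          Complex.I * ((SignType.sign z * Real.tan (Real.pi * r / 2) : ℝ) : ℂ) * (D : ℂ)) := by
      rw [hI, hD, ← integral_complex_ofReal, ← integral_complex_ofReal, ← integral_const_mul,
        ← integral_sub hint.ofReal (hintD.ofReal.const_mul _), ← integral_const_mul]
      refine integral_congr_ae (Eventually.of_forall fun s => ?_)
      dsimp only
      rw [show κ * z * f s = z * (κ * f s) by ring, stableSymbol_mul hr]
    rw [e]
    have hI0 : (I : ℂ) ≠ 0 := by exact_mod_cast hpos.ne'
    push_cast
    field_simp
    ring

/-- For r > 1 both 1 - r and cos(πr/2) change sign. -/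
lemma stableConst_pos {r : ℝ} (hr : r ∈ Set.Ioo (0 : ℝ) 2) : 0 < stableConst r := by
  unfold stableConst
  have hpi := Real.pi_pos
  split_ifs with h
  · positivity
  · have hG : 0 < Real.Gamma (2 - r) := Real.Gamma_pos_of_pos (by linarith [hr.2])
    rcases lt_or_gt_of_ne h with h | h
    · have : 0 < Real.cos (Real.pi * r / 2) :=
        Real.cos_pos_of_mem_Ioo ⟨by nlinarith [hr.1], by nlinarith⟩
      exact div_pos (by linarith) (mul_pos hG this)
    · have : Real.cos (Real.pi * r / 2) < 0 :=
        Real.cos_neg_of_pi_div_two_lt_of_lt (by nlinarith) (by nlinarith [hr.2])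
      exact div_pos_of_neg_of_neg (by linarith) (mul_neg_of_pos_of_neg hG this)

end Law

end StableCarma

namespace StableCarma

section Riccati

variable {n : Type*} [Fintype n]

/-! ### The discrete-time algebraic Riccati equation without measurement noise -/

lemma posSemidef_real_iff {M : Matrix n n ℝ} :
    M.PosSemidef ↔ Mᵀ = M ∧ ∀ x, 0 ≤ x ⬝ᵥ (M *ᵥ x) := by
  rw [Matrix.posSemidef_iff_dotProduct_mulVec]
  simp [Matrix.IsHermitian]

lemma posDef_real_iff {M : Matrix n n ℝ} :
    M.PosDef ↔ Mᵀ = M ∧ ∀ x, x ≠ 0 → 0 < x ⬝ᵥ (M *ᵥ x) := by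
  rw [Matrix.posDef_iff_dotProduct_mulVec]
  simp [Matrix.IsHermitian]

lemma dotProduct_mul_mul_transpose_mulVec {R : Type*} [CommRing R] (F S : Matrix n n R)
    (x y : n → R) :
    x ⬝ᵥ ((F * S * Fᵀ) *ᵥ y) = (x ᵥ* F) ⬝ᵥ (S *ᵥ (y ᵥ* F)) := by
  rw [← Matrix.mulVec_mulVec, ← Matrix.mulVec_mulVec, Matrix.mulVec_transpose,
    Matrix.dotProduct_mulVec]

variable (Φ Q : Matrix n n ℝ) (c : n → ℝ)

/-- The gain vector `(cᵀ S c)⁻¹ Φ S c`. -/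
noncomputable def riccatiGain (S : Matrix n n ℝ) : n → ℝ :=
  (c ⬝ᵥ (S *ᵥ c))⁻¹ • (Φ *ᵥ (S *ᵥ c))

/-- The Riccati map `S ↦ Φ S Φᵀ + Q - (Φ S c) (cᵀ S c)⁻¹ (Φ S c)ᵀ`. -/
noncomputable def riccatiMap (S : Matrix n n ℝ) : Matrix n n ℝ :=
  Φ * S * Φᵀ + Q - Matrix.vecMulVec (riccatiGain Φ c S) (Φ *ᵥ (S *ᵥ c))

/-- The closed loop matrix `Φ - K cᵀ` of the gain of `S`. -/
noncomputable def closedLoop (S : Matrix n n ℝ) : Matrix n n ℝ :=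
  Φ - Matrix.vecMulVec (riccatiGain Φ c S) c

variable {Φ Q c}

lemma vecMul_eq_mulVec_of_symm {S : Matrix n n ℝ} (hS : Sᵀ = S) (x : n → ℝ) :
    x ᵥ* S = S *ᵥ x := by
  rw [← Matrix.mulVec_transpose, hS]

lemma feedback_mul_mul_transpose {S : Matrix n n ℝ} (hS : Sᵀ = S) (l : n → ℝ) :
    (Φ - Matrix.vecMulVec l c) * S * (Φ - Matrix.vecMulVec l c)ᵀ =
      Φ * S * Φᵀ - Matrix.vecMulVec (Φ *ᵥ (S *ᵥ c)) l - Matrix.vecMulVec l (Φ *ᵥ (S *ᵥ c)) +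
        (c ⬝ᵥ (S *ᵥ c)) • Matrix.vecMulVec l l := by
  have h1 : Φ * S * Matrix.vecMulVec c l = Matrix.vecMulVec (Φ *ᵥ (S *ᵥ c)) l := by
    rw [Matrix.mul_vecMulVec, Matrix.mulVec_mulVec]
  have h2 : Matrix.vecMulVec l c * S * Φᵀ = Matrix.vecMulVec l (Φ *ᵥ (S *ᵥ c)) := by
    rw [Matrix.vecMulVec_mul, Matrix.vecMulVec_mul, vecMul_eq_mulVec_of_symm hS,
      Matrix.vecMul_transpose]
  have h3 : Matrix.vecMulVec l c * S * Matrix.vecMulVec c l =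
      (c ⬝ᵥ (S *ᵥ c)) • Matrix.vecMulVec l l := by
    rw [Matrix.vecMulVec_mul, Matrix.vecMulVec_mul_vecMulVec, vecMul_eq_mulVec_of_symm hS,
      dotProduct_comm, Matrix.vecMulVec_smul]
  rw [Matrix.transpose_sub, Matrix.transpose_vecMulVec, sub_mul, sub_mul, mul_sub, mul_sub,
    h1, h2, h3]
  abel

/-- Completing the square in the gain `l`: among all feedbacks the Riccati gain minimizes the
propagated covariance. Monotonicity and the upper bound below both come from inserting a suboptimal
gain. -/
lemma feedback_eq_riccatiMap_add {S : Matrix n n ℝ} (hS : Sᵀ = S) (hc : c ⬝ᵥ (S *ᵥ c) ≠ 0)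
    (l : n → ℝ) :
    (Φ - Matrix.vecMulVec l c) * S * (Φ - Matrix.vecMulVec l c)ᵀ + Q =
      riccatiMap Φ Q c S + (c ⬝ᵥ (S *ᵥ c)) •
        Matrix.vecMulVec (l - riccatiGain Φ c S) (l - riccatiGain Φ c S) := by
  rw [feedback_mul_mul_transpose hS, riccatiMap]
  ext i j
  simp only [Matrix.add_apply, Matrix.sub_apply, Matrix.smul_apply, Matrix.vecMulVec_apply,
    riccatiGain, Pi.sub_apply, Pi.smul_apply, smul_eq_mul]
  field_simp
  ring

/-- The Riccati map in Joseph form. -/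
lemma riccatiMap_eq {S : Matrix n n ℝ} (hS : Sᵀ = S) :
    riccatiMap Φ Q c S = closedLoop Φ c S * S * (closedLoop Φ c S)ᵀ + Q := by
  -- In the degenerate case the convention 0⁻¹ = 0 makes the gain zero, and both sides reduce to Φ S
  -- Φᵀ + Q.
  by_cases hc : c ⬝ᵥ (S *ᵥ c) = 0
  · have : riccatiGain Φ c S = 0 := by simp [riccatiGain, hc]
    simp [riccatiMap, closedLoop, this]
  · rw [closedLoop, feedback_eq_riccatiMap_add hS hc]
    simp

lemma dotProduct_vecMulVec_self (l x : n → ℝ) :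
    x ⬝ᵥ (Matrix.vecMulVec l l *ᵥ x) = (x ⬝ᵥ l) ^ 2 := by
  rw [Matrix.vecMulVec_mulVec, sq]
  simp [dotProduct_comm]

lemma riccatiMap_transpose {S : Matrix n n ℝ} (hS : Sᵀ = S) (hQ : Qᵀ = Q) :
    (riccatiMap Φ Q c S)ᵀ = riccatiMap Φ Q c S := by
  rw [riccatiMap_eq hS]
  simp [Matrix.transpose_mul, hS, hQ, Matrix.mul_assoc]

/-- The optimal gain of `T` is merely admissible for `S`, so the image of `S` is at most the closed
loop of `T` applied to `S`, which `S ≤ T` bounds. -/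
lemma riccatiMap_mono {S T : Matrix n n ℝ} (hS : Sᵀ = S) (hT : Tᵀ = T)
    (hc : 0 < c ⬝ᵥ (S *ᵥ c)) (h : ∀ x, x ⬝ᵥ (S *ᵥ x) ≤ x ⬝ᵥ (T *ᵥ x)) (x : n → ℝ) :
    x ⬝ᵥ (riccatiMap Φ Q c S *ᵥ x) ≤ x ⬝ᵥ (riccatiMap Φ Q c T *ᵥ x) := by
  have h1 := congrArg (fun M => x ⬝ᵥ (M *ᵥ x))
    (feedback_eq_riccatiMap_add (Φ := Φ) (Q := Q) hS hc.ne' (riccatiGain Φ c T))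
  rw [riccatiMap_eq hT]
  simp only [Matrix.add_mulVec, dotProduct_add, Matrix.smul_mulVec, dotProduct_smul,
    dotProduct_vecMulVec_self, smul_eq_mul, dotProduct_mul_mul_transpose_mulVec] at h1 ⊢
  have h2 := h (x ᵥ* closedLoop Φ c T)
  have h3 := mul_nonneg hc.le (sq_nonneg (x ⬝ᵥ (riccatiGain Φ c T - riccatiGain Φ c S)))
  rw [closedLoop] at h2 ⊢
  linarith

/-- Compare with the zero gain. -/
lemma riccatiMap_le {S : Matrix n n ℝ} (hS : Sᵀ = S) (hc : 0 < c ⬝ᵥ (S *ᵥ c)) (x : n → ℝ) :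
    x ⬝ᵥ (riccatiMap Φ Q c S *ᵥ x) ≤
      (x ᵥ* Φ) ⬝ᵥ (S *ᵥ (x ᵥ* Φ)) + x ⬝ᵥ (Q *ᵥ x) := by
  have h1 := congrArg (fun M => x ⬝ᵥ (M *ᵥ x))
    (feedback_eq_riccatiMap_add (Φ := Φ) (Q := Q) hS hc.ne' 0)
  simp only [Matrix.add_mulVec, dotProduct_add, Matrix.smul_mulVec, dotProduct_smul,
    dotProduct_vecMulVec_self, smul_eq_mul, Matrix.zero_vecMulVec, sub_zero,
    dotProduct_mul_mul_transpose_mulVec] at h1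
  have h3 := mul_nonneg hc.le (sq_nonneg (x ⬝ᵥ (0 - riccatiGain Φ c S)))
  linarith

lemma continuousAt_riccatiMap {S : Matrix n n ℝ} (hc : c ⬝ᵥ (S *ᵥ c) ≠ 0) :
    ContinuousAt (riccatiMap Φ Q c) S := by
  have h1 : Continuous fun S : Matrix n n ℝ => S *ᵥ c := by fun_prop
  have h2 : Continuous fun S : Matrix n n ℝ => Φ *ᵥ (S *ᵥ c) := by fun_prop
  have h3 : Continuous fun S : Matrix n n ℝ => c ⬝ᵥ (S *ᵥ c) := by fun_prop
  have h4 : ContinuousAt (riccatiGain Φ c) S := (h3.continuousAt.inv₀ hc).smul h2.continuousAt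
  refine ContinuousAt.sub (by fun_prop) ?_
  refine continuousAt_pi.2 fun i => continuousAt_pi.2 fun j => ?_
  exact (continuousAt_pi.1 h4 i).mul (continuousAt_pi.1 h2.continuousAt j)

/-- Increasing bounded sequences of symmetric matrices converge. -/
lemma exists_tendsto_of_monotone_quadratic {S : ℕ → Matrix n n ℝ} (hS : ∀ k, (S k)ᵀ = S k)
    (hm : ∀ x, Monotone fun k => x ⬝ᵥ (S k *ᵥ x))
    (hb : ∀ x, BddAbove (Set.range fun k => x ⬝ᵥ (S k *ᵥ x))) :
    ∃ S₀, Tendsto S atTop (𝓝 S₀) := by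
  classical
  have hq : ∀ x, ∃ l, Tendsto (fun k => x ⬝ᵥ (S k *ᵥ x)) atTop (𝓝 l) := fun x =>
    ⟨_, tendsto_atTop_ciSup (hm x) (hb x)⟩
  have hent : ∀ i j, ∃ l, Tendsto (fun k => S k i j) atTop (𝓝 l) := fun i j => by
    obtain ⟨a, ha⟩ := hq (Pi.single i 1 + Pi.single j 1)
    obtain ⟨b, hb⟩ := hq (Pi.single i 1)
    obtain ⟨d, hd⟩ := hq (Pi.single j 1)
    -- Polarization recovers the entries from the quadratic form.
    refine ⟨(a - b - d) / 2, (((ha.sub hb).sub hd).div_const 2).congr fun k => ?_⟩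
    have hji : S k j i = S k i j := congrFun (congrFun (hS k) i) j
    simp only [Matrix.mulVec_add, dotProduct_add, add_dotProduct, single_dotProduct,
      Matrix.mulVec_single_one, Matrix.col_apply, one_mul, hji]
    ring
  choose S₀ hS₀ using hent
  exact ⟨Matrix.of S₀, tendsto_pi_nhds.2 fun i => tendsto_pi_nhds.2 fun j => hS₀ i j⟩

/-- Solvability of the Riccati equation for positive definite `Q`, given a Lyapunov function of
`Φ`. -/
theorem exists_riccatiMap_eq (hQ : Q.PosDef) (hc : c ≠ 0) {B : (n → ℝ) → ℝ} (hB0 : ∀ x, 0 ≤ B x)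
    (hB : ∀ x, B (x ᵥ* Φ) + x ⬝ᵥ (Q *ᵥ x) ≤ B x) :
    ∃ S : Matrix n n ℝ, S.PosSemidef ∧ S = riccatiMap Φ Q c S := by
  obtain ⟨hQs, hQp⟩ := posDef_real_iff.1 hQ
  -- Starting at `Q` rather than 0 keeps every iterate above `Q`. Hence cᵀ S c stays positive, also
  -- in the limit, where continuity of the Riccati map is needed.
  let S : ℕ → Matrix n n ℝ := fun k => (riccatiMap Φ Q c)^[k] Q
  have hsucc : ∀ k, S (k + 1) = riccatiMap Φ Q c (S k) := fun k =>
    Function.iterate_succ_apply' _ _ _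
  have hsymm : ∀ k, (S k)ᵀ = S k := fun k => by
    induction k with
    | zero => exact hQs
    | succ k ih => rw [hsucc]; exact riccatiMap_transpose ih hQs
  have hQ0 : ∀ x, 0 ≤ x ⬝ᵥ (Q *ᵥ x) := (posSemidef_real_iff.1 hQ.posSemidef).2
  have hge : ∀ k x, x ⬝ᵥ (Q *ᵥ x) ≤ x ⬝ᵥ (S k *ᵥ x) := fun k => by
    induction k with
    | zero => exact fun x => le_rfl
    | succ k ih =>
      intro x
      rw [hsucc, riccatiMap_eq (hsymm k), Matrix.add_mulVec, dotProduct_add,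
        dotProduct_mul_mul_transpose_mulVec]
      have := (hQ0 (x ᵥ* closedLoop Φ c (S k))).trans (ih _)
      linarith
  have hcpos : ∀ k, 0 < c ⬝ᵥ (S k *ᵥ c) := fun k => (hQp c hc).trans_le (hge k c)
  have hmono : ∀ k x, x ⬝ᵥ (S k *ᵥ x) ≤ x ⬝ᵥ (S (k + 1) *ᵥ x) := fun k => by
    induction k with
    | zero => exact hge 1
    | succ k ih =>
      intro x
      rw [hsucc (k + 1), hsucc k]
      exact riccatiMap_mono (hsymm k) (riccatiMap_transpose (hsymm k) hQs) (hcpos k)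
        (by rw [← hsucc k]; exact ih) x
  have hle : ∀ k x, x ⬝ᵥ (S k *ᵥ x) ≤ B x := fun k => by
    induction k with
    | zero =>
        intro x
        have h1 := hB x
        have h2 := hB0 (x ᵥ* Φ)
        change x ⬝ᵥ (Q *ᵥ x) ≤ B x
        linarith
    | succ k ih =>
      intro x
      rw [hsucc]
      have h1 := riccatiMap_le (Φ := Φ) (Q := Q) (hsymm k) (hcpos k) x
      have h2 := ih (x ᵥ* Φ)
      have h3 := hB x
      linarith
  obtain ⟨S₀, hS₀⟩ := exists_tendsto_of_monotone_quadratic hsymm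
    (fun x => monotone_nat_of_le_succ fun k => hmono k x)
    (fun x => ⟨B x, by rintro _ ⟨k, rfl⟩; exact hle k x⟩)
  have hq : ∀ x, x ⬝ᵥ (Q *ᵥ x) ≤ x ⬝ᵥ (S₀ *ᵥ x) := fun x => by
    have hcont : Continuous fun S : Matrix n n ℝ => x ⬝ᵥ (S *ᵥ x) := by fun_prop
    exact ge_of_tendsto' ((hcont.tendsto S₀).comp hS₀) fun k => hge k x
  refine ⟨S₀, posSemidef_real_iff.2 ⟨?_, fun x => (hQ0 x).trans (hq x)⟩, ?_⟩
  · have hcont : Continuous fun S : Matrix n n ℝ => Sᵀ := by fun_prop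
    exact tendsto_nhds_unique (((hcont.tendsto S₀).comp hS₀).congr hsymm) hS₀
  · refine tendsto_nhds_unique (hS₀.comp (tendsto_add_atTop_nat 1)) ?_
    refine (((continuousAt_riccatiMap (Φ := Φ) (Q := Q)
      ((hQp c hc).trans_le (hq c)).ne').tendsto).comp hS₀).congr fun k => (hsucc k).symm

end Riccati

end StableCarma

namespace StableCarma

/-! ### Power summability from the spectral radius -/

section BanachAlgebra

/-- Elements of a complex Banach algebra of spectral radius less than one are power summable. -/
lemma summable_norm_pow_of_isUnit {𝔸 : Type*} [NormedRing 𝔸] [NormedAlgebra ℂ 𝔸]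
    [CompleteSpace 𝔸] {a : 𝔸} (h : ∀ z : ℂ, ‖z‖ ≤ 1 → IsUnit (1 - z • a)) :
    Summable fun k => ‖a ^ k‖ := by
  nontriviality 𝔸
  -- A spectral value k with |k| ≥ 1 would contradict the hypothesis at z = 1/k. Gelfand's formula
  -- then gives geometric decay of the powers.
  have hρ : spectralRadius ℂ a < 1 := by
    refine spectrum.spectralRadius_lt_of_forall_lt a (r := 1) fun k hk => ?_
    by_contra hcon
    rw [not_lt, ← NNReal.coe_le_coe, coe_nnnorm, NNReal.coe_one] at hcon
    have hk0 : k ≠ 0 := norm_pos_iff.1 (one_pos.trans_le hcon)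
    refine hk ?_
    have h1 := h k⁻¹ (by rw [norm_inv]; exact inv_le_one_of_one_le₀ hcon)
    have h2 : algebraMap ℂ 𝔸 k - a = (Units.mk0 k hk0) • (1 - k⁻¹ • a) := by
      rw [Units.smul_mk0, smul_sub, smul_smul, mul_inv_cancel₀ hk0, one_smul,
        Algebra.algebraMap_eq_smul_one]
    rw [spectrum.mem_resolventSet_iff, h2]
    exact h1.smul _
  obtain ⟨q, hq1, hq2⟩ := ENNReal.lt_iff_exists_nnreal_btwn.1 hρ
  have hev := (spectrum.pow_nnnorm_pow_one_div_tendsto_nhds_spectralRadius a).eventually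
    (gt_mem_nhds hq1)
  have hq2' : (q : ℝ) < 1 := by exact_mod_cast hq2
  refine Summable.of_norm_bounded_eventually_nat
    (summable_geometric_of_lt_one q.2 hq2') ?_
  filter_upwards [hev, eventually_gt_atTop 0] with k hk hk0
  have hk0' : (k : ℝ) ≠ 0 := by exact_mod_cast hk0.ne'
  have := ENNReal.rpow_le_rpow hk.le (Nat.cast_nonneg (α := ℝ) k)
  rw [← ENNReal.rpow_mul, one_div, inv_mul_cancel₀ hk0', ENNReal.rpow_one,
    ENNReal.rpow_natCast] at this
  rw [norm_norm]
  exact_mod_cast this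

end BanachAlgebra

/-! ### Matrix exponentials and resolvents -/

section Matrix

variable {n : Type*} [Fintype n] [DecidableEq n]

open scoped Matrix.Norms.Operator

/-- Exponentials act on eigenvectors by scalar exponentials. -/
lemma exp_mulVec_of_mulVec_eq {B : Matrix n n ℂ} {μ : ℂ} {w : n → ℂ} (h : B *ᵥ w = μ • w) :
    NormedSpace.exp B *ᵥ w = Complex.exp μ • w := by
  have hpow : ∀ k : ℕ, B ^ k *ᵥ w = μ ^ k • w := fun k => by
    induction k with
    | zero => simp
    | succ k ih => rw [pow_succ, ← Matrix.mulVec_mulVec, h, Matrix.mulVec_smul, ih, smul_smul,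
        pow_succ']
  have h1 := NormedSpace.exp_series_hasSum_exp' (𝕂 := ℂ) B
  have h2 := NormedSpace.exp_series_hasSum_exp' (𝕂 := ℂ) μ
  have h3 := h1.map (AddMonoidHom.mk' (fun M : Matrix n n ℂ => M *ᵥ w)
    fun M N => Matrix.add_mulVec M N w) (by
      change Continuous fun M : Matrix n n ℂ => M *ᵥ w
      fun_prop)
  have h4 := h2.smul_const w
  rw [← Complex.exp_eq_exp_ℂ] at h4
  refine h3.unique (h4.congr_fun fun k => ?_)
  change ((k.factorial : ℂ)⁻¹ • B ^ k) *ᵥ w = _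
  rw [Matrix.smul_mulVec, hpow, smul_assoc]

lemma map_exp_ofReal (B : Matrix n n ℝ) :
    (NormedSpace.exp B).map (fun x : ℝ => (x : ℂ)) =
      NormedSpace.exp (B.map fun x : ℝ => (x : ℂ)) := by
  have hc : Continuous (Complex.ofRealHom.mapMatrix : Matrix n n ℝ →+* Matrix n n ℂ) := by
    change Continuous fun M : Matrix n n ℝ => M.map fun x : ℝ => (x : ℂ)
    exact continuous_id.matrix_map Complex.continuous_ofReal
  exact NormedSpace.map_exp (Complex.ofRealHom.mapMatrix : Matrix n n ℝ →+* Matrix n n ℂ) hc B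

lemma summable_norm_pow_matrix {B : Matrix n n ℂ} (h : ∀ z : ℂ, ‖z‖ ≤ 1 → IsUnit (1 - z • B)) :
    Summable fun k => ‖B ^ k‖ :=
  summable_norm_pow_of_isUnit h

lemma differentiableAt_inv_one_sub_smul {B : Matrix n n ℂ} {z : ℂ} (h : IsUnit (1 - z • B))
    (i j : n) : DifferentiableAt ℂ (fun w : ℂ => (1 - w • B)⁻¹ i j) z := by
  have h1 : DifferentiableAt ℂ (fun w : ℂ => Ring.inverse (1 - w • B)) z :=
    (differentiableAt_inverse h).comp z
      (f := fun w : ℂ => 1 - w • B) ((differentiableAt_id.smul_const B).const_sub 1)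
  simp_rw [← Matrix.nonsing_inv_eq_ringInverse] at h1
  exact differentiableAt_pi.1 (differentiableAt_pi.1 h1 i) j

lemma hasDerivAt_exp_smul_matrix (B : Matrix n n ℝ) (t : ℝ) (i j : n) :
    HasDerivAt (fun u : ℝ => NormedSpace.exp (u • B) i j) ((NormedSpace.exp (t • B) * B) i j) t := by
  have h := hasDerivAt_exp_smul_const (𝕂 := ℝ) B t
  exact hasDerivAt_pi.1 (hasDerivAt_pi.1 h i) j

lemma summable_pow_matrix {B : Matrix n n ℂ} (h : ∀ z : ℂ, ‖z‖ ≤ 1 → IsUnit (1 - z • B)) {z : ℂ} (hz : ‖z‖ ≤ 1) :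
    Summable fun k => (z • B) ^ k := by
  refine Summable.of_norm_bounded (summable_norm_pow_matrix h) fun k => ?_
  rw [smul_pow, norm_smul, norm_pow]
  exact mul_le_of_le_one_left (norm_nonneg _) (pow_le_one₀ (norm_nonneg _) hz)

end Matrix

end StableCarma

namespace StableCarma

section HermForm

variable {n : Type*} [Fintype n]

/-! ### Hermitian forms of real matrices -/

/-- The Hermitian form `y M y*` of a real symmetric matrix. -/
def hermForm (M : Matrix n n ℝ) (y : n → ℂ) : ℝ :=
  (fun i => (y i).re) ⬝ᵥ (M *ᵥ fun i => (y i).re) +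
    (fun i => (y i).im) ⬝ᵥ (M *ᵥ fun i => (y i).im)

lemma hermForm_add (M N : Matrix n n ℝ) (y : n → ℂ) :
    hermForm (M + N) y = hermForm M y + hermForm N y := by
  simp only [hermForm, Matrix.add_mulVec, dotProduct_add]; ring

lemma re_dotProduct_ofReal (y : n → ℂ) (x : n → ℝ) :
    (y ⬝ᵥ fun i => (x i : ℂ)).re = (fun i => (y i).re) ⬝ᵥ x := by
  simp [dotProduct]

lemma im_dotProduct_ofReal (y : n → ℂ) (x : n → ℝ) :
    (y ⬝ᵥ fun i => (x i : ℂ)).im = (fun i => (y i).im) ⬝ᵥ x := by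
  simp [dotProduct]

lemma hermForm_conj (F S : Matrix n n ℝ) (y : n → ℂ) :
    hermForm (F * S * Fᵀ) y = hermForm S (y ᵥ* F.map fun x : ℝ => (x : ℂ)) := by
  have h1 : (fun i => ((y ᵥ* F.map fun x : ℝ => (x : ℂ)) i).re) =
      (fun i => (y i).re) ᵥ* F := by
    ext i; exact re_dotProduct_ofReal y fun k => F k i
  have h2 : (fun i => ((y ᵥ* F.map fun x : ℝ => (x : ℂ)) i).im) =
      (fun i => (y i).im) ᵥ* F := by
    ext i; exact im_dotProduct_ofReal y fun k => F k i
  rw [hermForm, hermForm, h1, h2, dotProduct_mul_mul_transpose_mulVec,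
    dotProduct_mul_mul_transpose_mulVec]

lemma dotProduct_mulVec_comm_of_symm {S : Matrix n n ℝ} (hS : Sᵀ = S) (x y : n → ℝ) :
    x ⬝ᵥ (S *ᵥ y) = y ⬝ᵥ (S *ᵥ x) := by
  rw [Matrix.dotProduct_mulVec, vecMul_eq_mulVec_of_symm hS, dotProduct_comm]

/-- Expands the form at the decomposition y = c + z y e^{AΔ} of the resolvent row, as needed for the
spectral factorization. -/
lemma hermForm_ofReal_add_smul {S : Matrix n n ℝ} (hS : Sᵀ = S) (x : n → ℝ) (z : ℂ)
    (w : n → ℂ) :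
    hermForm S ((fun i => (x i : ℂ)) + z • w) =
      x ⬝ᵥ (S *ᵥ x) + 2 * (z * (w ⬝ᵥ fun i => ((S *ᵥ x) i : ℂ))).re +
        ‖z‖ ^ 2 * hermForm S w := by
  have h1 : (fun i => (((fun i => (x i : ℂ)) + z • w) i).re) =
      x + (z.re • (fun i => (w i).re) - z.im • fun i => (w i).im) := by
    ext i; simp
  have h2 : (fun i => (((fun i => (x i : ℂ)) + z • w) i).im) =
      z.re • (fun i => (w i).im) + z.im • fun i => (w i).re := by
    ext i; simp
  rw [hermForm, hermForm, h1, h2, Complex.mul_re, re_dotProduct_ofReal, im_dotProduct_ofReal,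
    Complex.sq_norm, Complex.normSq_apply]
  simp only [Matrix.mulVec_add, Matrix.mulVec_sub, Matrix.mulVec_smul, dotProduct_add,
    dotProduct_sub, dotProduct_smul, add_dotProduct, sub_dotProduct, smul_dotProduct, smul_eq_mul]
  rw [dotProduct_mulVec_comm_of_symm hS x fun i => (w i).re,
    dotProduct_mulVec_comm_of_symm hS x fun i => (w i).im,
    dotProduct_mulVec_comm_of_symm hS (fun i => (w i).re) fun i => (w i).im]
  ring

lemma hermForm_smul {S : Matrix n n ℝ} (hS : Sᵀ = S) (z : ℂ) (w : n → ℂ) :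
    hermForm S (z • w) = ‖z‖ ^ 2 * hermForm S w := by
  have := hermForm_ofReal_add_smul hS 0 z w
  have e : (fun i => ((0 : n → ℝ) i : ℂ)) + z • w = z • w := by ext i; simp
  rw [e, Matrix.mulVec_zero] at this
  simpa [← Pi.zero_def] using this

lemma hermForm_nonneg {S : Matrix n n ℝ} (hS : S.PosSemidef) (y : n → ℂ) : 0 ≤ hermForm S y :=
  add_nonneg ((posSemidef_real_iff.1 hS).2 _) ((posSemidef_real_iff.1 hS).2 _)

lemma hermForm_pos {S : Matrix n n ℝ} (hS : S.PosDef) {y : n → ℂ} (hy : y ≠ 0) :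
    0 < hermForm S y := by
  by_cases h : (fun i => (y i).re) = 0
  · have h' : (fun i => (y i).im) ≠ 0 := fun h' => hy (by
      ext i
      exact Complex.ext (congrFun h i) (congrFun h' i))
    exact add_pos_of_nonneg_of_pos ((posSemidef_real_iff.1 hS.posSemidef).2 _)
      ((posDef_real_iff.1 hS).2 _ h')
  · exact add_pos_of_pos_of_nonneg ((posDef_real_iff.1 hS).2 _ h)
      ((posSemidef_real_iff.1 hS.posSemidef).2 _)

/-- Solutions of a Lyapunov equation with positive definite right-hand side certify stability. -/
lemma isUnit_one_sub_smul_of_lyapunov [DecidableEq n] {F S Q : Matrix n n ℝ} (hS : S.PosSemidef)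
    (hQ : Q.PosDef) (h : S = F * S * Fᵀ + Q) {z : ℂ} (hz : ‖z‖ ≤ 1) :
    IsUnit (1 - z • F.map fun x : ℝ => (x : ℂ)) := by
  rw [Matrix.isUnit_iff_isUnit_det, isUnit_iff_ne_zero]
  intro hdet
  -- A left null vector satisfies v = z vF, so the form of `S` at `v` is at most that at `vF`. The
  -- Lyapunov equation says that it is larger by the positive form of `Q` at `v`.
  obtain ⟨v, hv, hv0⟩ := Matrix.exists_vecMul_eq_zero_iff.2 hdet
  rw [Matrix.vecMul_sub, Matrix.vecMul_one, sub_eq_zero, Matrix.vecMul_smul] at hv0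
  have h1 := congrArg (fun M => hermForm M v) h
  simp only [hermForm_add, hermForm_conj] at h1
  have h2 := hermForm_smul (posSemidef_real_iff.1 hS).1 z (v ᵥ* F.map fun x : ℝ => (x : ℂ))
  rw [← hv0] at h2
  have h3 := hermForm_pos hQ hv
  have h4 := hermForm_nonneg hS (v ᵥ* F.map fun x : ℝ => (x : ℂ))
  have h5 : ‖z‖ ^ 2 ≤ 1 := pow_le_one₀ (norm_nonneg _) hz
  nlinarith

end HermForm

/-! ### Lyapunov sums of stable matrices -/

section Summability

variable {n : Type*} [Fintype n] [DecidableEq n]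

open scoped Matrix.Norms.Operator

lemma norm_map_ofReal (B : Matrix n n ℝ) : ‖B.map fun x : ℝ => (x : ℂ)‖ = ‖B‖ := by
  simp [Matrix.linfty_opNorm_def]

/-- Quadratic forms are summable along the powers of a stable matrix. -/
lemma summable_quadratic_pow {Φ : Matrix n n ℝ}
    (h : ∀ z : ℂ, ‖z‖ ≤ 1 → IsUnit (1 - z • Φ.map fun x : ℝ => (x : ℂ))) (Q : Matrix n n ℝ)
    (x : n → ℝ) : Summable fun k => (x ᵥ* Φ ^ k) ⬝ᵥ (Q *ᵥ (x ᵥ* Φ ^ k)) := by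
  have hs : Summable fun k => ‖Φ ^ k‖ := by
    refine (summable_norm_pow_matrix h).congr fun k => ?_
    rw [← norm_map_ofReal (Φ ^ k)]
    congr 1
    exact (map_pow (Complex.ofRealHom.mapMatrix : Matrix n n ℝ →+* Matrix n n ℂ) Φ k).symm
  -- The row-sum norm is not invariant under transposition; continuity of the transpose still makes
  -- these factors eventually less than one.
  have ht : Tendsto (fun k => ‖(Φ ^ k)ᵀ‖) atTop (𝓝 0) := by
    have h1 : Tendsto (fun k => Φ ^ k) atTop (𝓝 0) := hs.of_norm.tendsto_atTop_zero
    have h2 : Continuous fun M : Matrix n n ℝ => Mᵀ := by fun_prop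
    simpa using ((h2.tendsto 0).comp h1).norm
  have hM : Summable fun k => Φ ^ k * Q * (Φ ^ k)ᵀ := by
    refine Summable.of_norm_bounded_eventually_nat (hs.mul_right ‖Q‖) ?_
    filter_upwards [ht.eventually (gt_mem_nhds one_pos)] with k hk
    calc ‖Φ ^ k * Q * (Φ ^ k)ᵀ‖ ≤ ‖Φ ^ k‖ * ‖Q‖ * ‖(Φ ^ k)ᵀ‖ :=
          (norm_mul_le _ _).trans (mul_le_mul_of_nonneg_right (norm_mul_le _ _) (norm_nonneg _))
      _ ≤ ‖Φ ^ k‖ * ‖Q‖ := mul_le_of_le_one_right (by positivity) hk.le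
  have := hM.map (AddMonoidHom.mk' (fun M : Matrix n n ℝ => x ⬝ᵥ (M *ᵥ x)) fun M N => by
    rw [Matrix.add_mulVec, dotProduct_add]) (by
      change Continuous fun M : Matrix n n ℝ => x ⬝ᵥ (M *ᵥ x)
      fun_prop)
  exact this.congr fun k => dotProduct_mul_mul_transpose_mulVec _ _ _ _

end Summability

namespace CarmaCoeffs

variable {p : ℕ} {M : CarmaCoeffs} {Δ : ℝ}

/-! ### The state transition matrix of a CARMA model -/

/-- An eigenspace of e^{AΔ} is invariant under the commuting matrix A, hence contains an eigenvector
of A. So the eigenvalue 1/z equals e^{Δμ} with Re μ < 0 and has modulus less than one. -/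
lemma isUnit_one_sub_smul_expA (hΔ : 0 < Δ)
    (hst : ∀ z ∈ spectrum ℂ ((M.A p).map fun x : ℝ => (x : ℂ)), z.re < 0) {z : ℂ}
    (hz : ‖z‖ ≤ 1) : IsUnit (1 - z • (M.expA p Δ).map fun x : ℝ => (x : ℂ)) := by
  rw [Matrix.isUnit_iff_isUnit_det, isUnit_iff_ne_zero]
  intro hdet
  obtain ⟨v, hv, hv0⟩ := Matrix.exists_mulVec_eq_zero_iff.2 hdet
  rw [Matrix.sub_mulVec, Matrix.one_mulVec, sub_eq_zero, Matrix.smul_mulVec] at hv0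
  have hz0 : z ≠ 0 := by rintro rfl; rw [zero_smul] at hv0; exact hv hv0
  set Ac : Matrix (Fin p) (Fin p) ℂ := (M.A p).map fun x : ℝ => (x : ℂ) with hAc
  set Φ : Matrix (Fin p) (Fin p) ℂ := (M.expA p Δ).map fun x : ℝ => (x : ℂ) with hΦ
  have hcomm : Commute Ac Φ := by
    have h1 : Commute (M.A p) (M.expA p Δ) := (Commute.refl (M.A p)).smul_right Δ |>.exp_right
    exact h1.map (Complex.ofRealHom.mapMatrix : Matrix (Fin p) (Fin p) ℝ →+* _)
  let E := Module.End.eigenspace (Matrix.toLin' Φ) z⁻¹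
  have hE : ∀ w, w ∈ E ↔ Φ *ᵥ w = z⁻¹ • w := fun w => by
    rw [Module.End.mem_eigenspace_iff, Matrix.toLin'_apply]
  have hmaps : ∀ w ∈ E, Matrix.toLin' Ac w ∈ E := fun w hw => by
    rw [hE] at hw ⊢
    rw [Matrix.toLin'_apply, Matrix.mulVec_mulVec, ← hcomm.eq, ← Matrix.mulVec_mulVec, hw,
      Matrix.mulVec_smul]
  have hvE : v ∈ E := by
    rw [hE]
    conv_rhs => rw [hv0]
    rw [smul_smul, inv_mul_cancel₀ hz0, one_smul]
  have : Nontrivial E := ⟨⟨⟨v, hvE⟩, 0, fun h => hv (congrArg Subtype.val h)⟩⟩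
  obtain ⟨μ, hμ⟩ := Module.End.exists_eigenvalue ((Matrix.toLin' Ac).restrict hmaps)
  obtain ⟨⟨w, hwE⟩, hw⟩ := hμ.exists_hasEigenvector
  have hw0 : w ≠ 0 := fun h => hw.2 (Subtype.ext h)
  have hwA : Ac *ᵥ w = μ • w := congrArg Subtype.val hw.apply_eq_smul
  have hμs : μ ∈ spectrum ℂ Ac := by
    rw [← Matrix.spectrum_toLin']
    exact (Module.End.hasEigenvalue_of_hasEigenvector
      (Module.End.hasEigenvector_iff.2 ⟨Module.End.mem_eigenspace_iff.2 hwA, hw0⟩)).mem_spectrum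
  have hexp : Φ *ᵥ w = Complex.exp (Δ * μ) • w := by
    rw [hΦ, expA, map_exp_ofReal]
    refine exp_mulVec_of_mulVec_eq ?_
    have : ((Δ • M.A p).map fun x : ℝ => (x : ℂ)) = (Δ : ℂ) • Ac := by ext i j; simp [hAc]
    rw [this, Matrix.smul_mulVec, hwA, smul_smul]
  rw [(hE w).1 hwE] at hexp
  have hzμ : z⁻¹ = Complex.exp (Δ * μ) := smul_left_injective ℂ hw0 hexp
  have h1 : 1 ≤ ‖z⁻¹‖ := by
    rw [norm_inv]
    exact (one_le_inv₀ (norm_pos_iff.2 hz0)).2 hz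
  rw [hzμ, Complex.norm_exp] at h1
  have h2 : ((Δ : ℂ) * μ).re < 0 := by
    rw [Complex.re_ofReal_mul]
    exact mul_neg_of_pos_of_neg hΔ (hst μ hμs)
  exact absurd h1 (not_le.2 (Real.exp_zero ▸ Real.exp_lt_exp.2 h2))

lemma expA_add (s t : ℝ) : M.expA p (s + t) = M.expA p s * M.expA p t := by
  rw [expA, add_smul]
  exact Matrix.exp_add_of_commute _ _ (((Commute.refl (M.A p)).smul_right t).smul_left s)

lemma expA_zero : M.expA p 0 = 1 := by
  rw [expA, zero_smul, NormedSpace.exp_zero]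

lemma expA_nat_mul (k : ℕ) : M.expA p (k * Δ) = M.expA p Δ ^ k := by
  induction k with
  | zero => simp [expA_zero]
  | succ k ih => rw [Nat.cast_succ, add_mul, one_mul, expA_add, ih, pow_succ]

lemma hasDerivAt_expA (x y : Fin p → ℝ) (t : ℝ) :
    HasDerivAt (fun u => x ⬝ᵥ (M.expA p u *ᵥ y)) (x ⬝ᵥ (M.expA p t *ᵥ (M.A p *ᵥ y))) t := by
  rw [Matrix.mulVec_mulVec]
  simp only [dotProduct, Matrix.mulVec]
  refine HasDerivAt.fun_sum fun i _ => HasDerivAt.const_mul _ ?_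
  refine HasDerivAt.fun_sum fun j _ => HasDerivAt.mul_const ?_ _
  exact hasDerivAt_exp_smul_matrix (M.A p) t i j

lemma continuous_expA : Continuous fun u => M.expA p u := by
  refine continuous_pi fun i => continuous_pi fun j => ?_
  exact continuous_iff_continuousAt.2 fun t =>
    (hasDerivAt_exp_smul_matrix (M.A p) t i j).continuousAt

/-- Controllability of companion matrices. -/
lemma eq_zero_of_forall_dotProduct_pow {w : Fin p → ℝ}
    (h : ∀ k : ℕ, w ⬝ᵥ ((M.A p) ^ k *ᵥ e p) = 0) : w = 0 := by
  have key : ∀ m : ℕ, ∀ hm : m < p, ∀ k : ℕ,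
      w ⬝ᵥ ((M.A p) ^ k *ᵥ (Pi.single (⟨p - 1 - m, by omega⟩ : Fin p) (1 : ℝ))) = 0 := by
    intro m
    induction m with
    | zero =>
      intro hm k
      rw [← h k]
      congr 2
      ext i
      simp only [e, Pi.single_apply, Fin.ext_iff]
      congr 1
      simp; omega
    | succ m ih =>
      intro hm k
      -- Column recursion of the companion matrix: applying A to a unit vector gives its predecessor
      -- plus a multiple of e_p. Descending from e_p reaches the whole basis.
      have hrec : (Pi.single (⟨p - 1 - (m + 1), by omega⟩ : Fin p) (1 : ℝ)) =
          M.A p *ᵥ (Pi.single (⟨p - 1 - m, by omega⟩ : Fin p) (1 : ℝ)) +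
            M.ar (p - (p - 1 - m)) • e p := by
        ext i
        simp only [Matrix.mulVec_single_one, Matrix.col_apply, A, Matrix.of_apply, e, Pi.add_apply,
          Pi.smul_apply, smul_eq_mul, Pi.single_apply, Fin.ext_iff]
        split_ifs <;> first | omega | simp
      rw [hrec, Matrix.mulVec_add, Matrix.mulVec_smul, dotProduct_add, dotProduct_smul, h k,
        Matrix.mulVec_mulVec, ← pow_succ, ih (by omega) (k + 1)]
      simp
  ext i
  have := key (p - 1 - i) (by omega) 0
  have hi : (⟨p - 1 - (p - 1 - i), by omega⟩ : Fin p) = i := Fin.ext (by simp; omega)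
  rwa [hi, pow_zero, Matrix.one_mulVec, dotProduct_single_one] at this

/-! ### The noise covariance -/

lemma continuous_dotProduct_expA (x y : Fin p → ℝ) :
    Continuous fun u => x ⬝ᵥ (M.expA p u *ᵥ y) :=
  continuous_iff_continuousAt.2 fun t => (M.hasDerivAt_expA x y t).continuousAt

lemma noiseCov_apply (i j : Fin p) :
    M.noiseCov p Δ i j = ∫ u in (0 : ℝ)..Δ, (M.expA p u *ᵥ e p) i * (M.expA p u *ᵥ e p) j := by
  rw [noiseCov, Matrix.of_apply]
  congr 1
  ext u
  rw [Matrix.mul_vecMulVec, Matrix.vecMulVec_mul, Matrix.vecMul_transpose]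
  rfl

lemma dotProduct_noiseCov_mulVec (x : Fin p → ℝ) :
    x ⬝ᵥ (M.noiseCov p Δ *ᵥ x) = ∫ u in (0 : ℝ)..Δ, (x ⬝ᵥ (M.expA p u *ᵥ e p)) ^ 2 := by
  have key : ∀ b : ℝ → Fin p → ℝ, Continuous b →
      ∑ i, x i * ∑ j, (∫ u in (0 : ℝ)..Δ, b u i * b u j) * x j =
        ∫ u in (0 : ℝ)..Δ, (∑ i, x i * b u i) ^ 2 := by
    intro b hb
    simp_rw [sq, Finset.sum_mul_sum]
    rw [intervalIntegral.integral_finsetSum fun i _ =>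
      Continuous.intervalIntegrable (by fun_prop) _ _]
    refine Finset.sum_congr rfl fun i _ => ?_
    rw [intervalIntegral.integral_finsetSum fun i _ =>
      Continuous.intervalIntegrable (by fun_prop) _ _, Finset.mul_sum]
    refine Finset.sum_congr rfl fun j _ => ?_
    rw [← intervalIntegral.integral_mul_const, ← intervalIntegral.integral_const_mul]
    congr 1
    ext u
    ring
  refine Eq.trans ?_ (key (fun u => M.expA p u *ᵥ e p)
    (M.continuous_expA.matrix_mulVec continuous_const))
  simp only [dotProduct, Matrix.mulVec, noiseCov_apply]

/-- The quadratic form is the integral of (xᵀ e^{Au} e_p)². If it vanished, so would all derivatives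
of u ↦ xᵀ e^{Au} e_p; controllability at u = Δ/2 and invertibility of the exponential then give x =
0. -/
lemma noiseCov_posDef (hΔ : 0 < Δ) : (M.noiseCov p Δ).PosDef := by
  refine posDef_real_iff.2 ⟨?_, fun x hx => ?_⟩
  · ext i j
    rw [Matrix.transpose_apply, noiseCov_apply, noiseCov_apply]
    simp_rw [mul_comm]
  · rw [dotProduct_noiseCov_mulVec]
    refine intervalIntegral.integral_pos hΔ
      ((M.continuous_dotProduct_expA x (e p)).pow 2).continuousOn (fun u _ => sq_nonneg _) ?_
    by_contra! hcon
    have h0 : ∀ u ∈ Set.Ioo 0 Δ, x ⬝ᵥ (M.expA p u *ᵥ e p) = 0 := fun u hu =>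
      pow_eq_zero_iff two_ne_zero |>.1
        (le_antisymm (hcon u (Set.Ioo_subset_Icc_self hu)) (sq_nonneg _))
    have hk : ∀ k : ℕ, ∀ u ∈ Set.Ioo 0 Δ, x ⬝ᵥ (M.expA p u *ᵥ ((M.A p) ^ k *ᵥ e p)) = 0 := by
      intro k
      induction k with
      | zero => simpa using h0
      | succ k ih =>
        intro u hu
        have h1 := M.hasDerivAt_expA x ((M.A p) ^ k *ᵥ e p) u
        have h2 : HasDerivAt (fun u => x ⬝ᵥ (M.expA p u *ᵥ ((M.A p) ^ k *ᵥ e p))) 0 u := by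
          refine (hasDerivAt_const u (0 : ℝ)).congr_of_eventuallyEq ?_
          filter_upwards [isOpen_Ioo.mem_nhds hu] with t ht using ih t ht
        rw [pow_succ', ← Matrix.mulVec_mulVec]
        exact h1.unique h2
    have hmid : Δ / 2 ∈ Set.Ioo 0 Δ := ⟨by linarith, by linarith⟩
    have hw : x ᵥ* M.expA p (Δ / 2) = 0 := M.eq_zero_of_forall_dotProduct_pow fun k => by
      rw [← Matrix.dotProduct_mulVec]
      exact hk k _ hmid
    apply hx
    have h3 : M.expA p (Δ / 2) * M.expA p (-(Δ / 2)) = 1 := by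
      rw [← expA_add, add_neg_cancel, expA_zero]
    rw [← Matrix.vecMul_one x, ← h3, ← Matrix.vecMul_vecMul, hw, Matrix.zero_vecMul]

lemma hermForm_noiseCov (y : Fin p → ℂ) :
    hermForm (M.noiseCov p Δ) y =
      ∫ u in (0 : ℝ)..Δ, ‖y ⬝ᵥ fun i => ((M.expA p u *ᵥ e p) i : ℂ)‖ ^ 2 := by
  rw [hermForm, dotProduct_noiseCov_mulVec, dotProduct_noiseCov_mulVec,
    ← intervalIntegral.integral_add]
  · congr 1
    ext u
    rw [Complex.sq_norm, Complex.normSq_apply, re_dotProduct_ofReal, im_dotProduct_ofReal]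
    ring
  · exact ((M.continuous_dotProduct_expA _ _).pow 2).intervalIntegrable _ _
  · exact ((M.continuous_dotProduct_expA _ _).pow 2).intervalIntegrable _ _

/-! ### The Riccati solution and the Kalman gain -/

/-- The first entry of `c` is the coefficient of index q, nonzero by minimality of q. -/
lemma c_ne_zero (hma : ∃ j < p, M.ma j ≠ 0) : M.c p ≠ 0 := by
  obtain ⟨j, hj, hj0⟩ := hma
  have hne : {j : ℕ | j < p ∧ ∀ l, j < l → l < p → M.ma l = 0}.Nonempty :=
    ⟨p - 1, by omega, fun l h1 h2 => by omega⟩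
  have hq : M.q p < p ∧ ∀ l, M.q p < l → l < p → M.ma l = 0 := Nat.sInf_mem hne
  have hp : 0 < p := by omega
  have hmq : M.ma (M.q p) ≠ 0 := by
    intro h0
    have hj' : j < M.q p := by
      by_contra! hcon
      rcases hcon.eq_or_lt with h | h
      · exact hj0 (h ▸ h0)
      · exact hj0 (hq.2 j h hj)
    have : M.q p ≤ M.q p - 1 := Nat.sInf_le ⟨by omega, fun l h1 h2 => by
      rcases (show M.q p ≤ l by omega).eq_or_lt with h | h
      · exact h ▸ h0
      · exact hq.2 l h h2⟩
    omega
  intro h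
  have := congrFun h ⟨0, hp⟩
  simp [c] at this
  exact hmq this

lemma exists_isRiccatiSol (hΔ : 0 < Δ)
    (hst : ∀ z ∈ spectrum ℂ ((M.A p).map fun x : ℝ => (x : ℂ)), z.re < 0)
    (hma : ∃ j < p, M.ma j ≠ 0) : ∃ S, M.IsRiccatiSol p Δ S := by
  have hsum := summable_quadratic_pow (fun z hz => M.isUnit_one_sub_smul_expA hΔ hst hz)
    (M.noiseCov p Δ)
  have hQ := M.noiseCov_posDef (p := p) hΔ
  refine exists_riccatiMap_eq (Φ := M.expA p Δ) hQ (M.c_ne_zero hma)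
    -- Splitting off the term k = 0 gives the Lyapunov identity B(xΦ) + xᵀQx = B(x), with equality.
    (B := fun x => ∑' k, (x ᵥ* M.expA p Δ ^ k) ⬝ᵥ (M.noiseCov p Δ *ᵥ (x ᵥ* M.expA p Δ ^ k)))
    (fun x => tsum_nonneg fun k => (posSemidef_real_iff.1 hQ.posSemidef).2 _) fun x => ?_
  rw [(hsum x).tsum_eq_zero_add, add_comm]
  simp [Matrix.vecMul_vecMul, ← pow_succ']

lemma isRiccatiSol_riccati (hΔ : 0 < Δ)
    (hst : ∀ z ∈ spectrum ℂ ((M.A p).map fun x : ℝ => (x : ℂ)), z.re < 0)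
    (hma : ∃ j < p, M.ma j ≠ 0) : M.IsRiccatiSol p Δ (M.riccati p Δ) := by
  have h := M.exists_isRiccatiSol hΔ hst hma
  rw [riccati, dif_pos h]
  exact h.choose_spec

/-- The Joseph form turns the Riccati equation into a Lyapunov equation for `F`, from which
stability of the prediction filter is read off. -/
lemma riccati_eq_closedLoop (h : M.IsRiccatiSol p Δ (M.riccati p Δ)) :
    M.riccati p Δ = M.F p Δ * M.riccati p Δ * (M.F p Δ)ᵀ + M.noiseCov p Δ :=
  h.2.trans (riccatiMap_eq (posSemidef_real_iff.1 h.1).1)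

lemma isUnit_one_sub_smul_F (hΔ : 0 < Δ) (h : M.IsRiccatiSol p Δ (M.riccati p Δ)) {z : ℂ}
    (hz : ‖z‖ ≤ 1) : IsUnit (1 - z • (M.F p Δ).map fun x : ℝ => (x : ℂ)) :=
  isUnit_one_sub_smul_of_lyapunov h.1 (M.noiseCov_posDef hΔ) (M.riccati_eq_closedLoop h) hz

lemma predictionVariance_pos (hΔ : 0 < Δ) (h : M.IsRiccatiSol p Δ (M.riccati p Δ))
    (hma : ∃ j < p, M.ma j ≠ 0) : 0 < M.c p ⬝ᵥ (M.riccati p Δ *ᵥ M.c p) := by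
  rw [M.riccati_eq_closedLoop h, Matrix.add_mulVec, dotProduct_add,
    dotProduct_mul_mul_transpose_mulVec]
  exact add_pos_of_nonneg_of_pos ((posSemidef_real_iff.1 h.1).2 _)
    ((posDef_real_iff.1 (M.noiseCov_posDef hΔ)).2 _ (M.c_ne_zero hma))

end CarmaCoeffs

end StableCarma

/-! ### Spectral factorization of the sampled model -/

namespace StableCarma

lemma ofReal_dotProduct_mulVec {n : Type*} [Fintype n] (x y : n → ℝ) (B : Matrix n n ℝ) :
    ((x ⬝ᵥ (B *ᵥ y) : ℝ) : ℂ) =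
      (fun i => (x i : ℂ)) ⬝ᵥ (B.map (fun x : ℝ => (x : ℂ)) *ᵥ fun i => (y i : ℂ)) := by
  simp [dotProduct, Matrix.mulVec]

lemma ofReal_mulVec {n : Type*} [Fintype n] (y : n → ℝ) (B : Matrix n n ℝ) :
    (fun i => (((B *ᵥ y) i : ℝ) : ℂ)) =
      B.map (fun x : ℝ => (x : ℂ)) *ᵥ fun i => (y i : ℂ) := by
  ext i; simp [dotProduct, Matrix.mulVec]

namespace CarmaCoeffs

variable (p : ℕ) (M : CarmaCoeffs) (Δ : ℝ)

/-- The row vector `cᵀ (I - z e^{A Δ})⁻¹`. -/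
noncomputable def resolventRow (z : ℂ) : Fin p → ℂ :=
  (fun i => (M.c p i : ℂ)) ᵥ* (1 - z • (M.expA p Δ).map fun x : ℝ => (x : ℂ))⁻¹

/-- The transfer function `1 + z cᵀ (I - z e^{A Δ})⁻¹ K` of the innovations representation. -/
noncomputable def innovationTransfer (z : ℂ) : ℂ :=
  1 + z * (M.resolventRow p Δ z ⬝ᵥ fun i => (M.gain p Δ i : ℂ))

variable {p M Δ}

lemma resolventRow_eq {z : ℂ}
    (h : IsUnit (1 - z • (M.expA p Δ).map fun x : ℝ => (x : ℂ))) :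
    M.resolventRow p Δ z = (fun i => (M.c p i : ℂ)) +
      z • (M.resolventRow p Δ z ᵥ* (M.expA p Δ).map fun x : ℝ => (x : ℂ)) := by
  have h1 : M.resolventRow p Δ z ᵥ* (1 - z • (M.expA p Δ).map fun x : ℝ => (x : ℂ)) =
      fun i => (M.c p i : ℂ) := by
    rw [resolventRow, Matrix.vecMul_vecMul, Matrix.nonsing_inv_mul _
      ((Matrix.isUnit_iff_isUnit_det _).1 h), Matrix.vecMul_one]
  rw [Matrix.vecMul_sub, Matrix.vecMul_one, Matrix.vecMul_smul, sub_eq_iff_eq_add] at h1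
  exact h1

/-- The innovations filter inverts the prediction error filter. -/
lemma transfer_mul_innovationTransfer {z : ℂ}
    (hΦ : IsUnit (1 - z • (M.expA p Δ).map fun x : ℝ => (x : ℂ)))
    (hF : IsUnit (1 - z • (M.F p Δ).map fun x : ℝ => (x : ℂ))) :
    M.transfer p Δ z * M.innovationTransfer p Δ z = 1 := by
  set cc : Fin p → ℂ := fun i => (M.c p i : ℂ) with hcc
  set K : Fin p → ℂ := fun i => (M.gain p Δ i : ℂ) with hK
  set Φ : Matrix (Fin p) (Fin p) ℂ := (M.expA p Δ).map fun x : ℝ => (x : ℂ) with hΦd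
  set F : Matrix (Fin p) (Fin p) ℂ := (M.F p Δ).map fun x : ℝ => (x : ℂ) with hFd
  set y : Fin p → ℂ := cc ᵥ* (1 - z • F)⁻¹ with hy
  -- The two resolvents differ by a rank-one perturbation, so the row vectors cᵀ(I - zF)⁻¹ and cᵀ(I
  -- - zΦ)⁻¹ are proportional, with factor the transfer function.
  have hFe : 1 - z • F = (1 - z • Φ) + z • Matrix.vecMulVec K cc := by
    have : F = Φ - Matrix.vecMulVec K cc := by
      ext i j; simp [hFd, hΦd, CarmaCoeffs.F, Matrix.vecMulVec_apply, hK, hcc]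
    rw [this, smul_sub]; abel
  have htr : M.transfer p Δ z = 1 - z * (y ⬝ᵥ K) := by
    change 1 - cc ⬝ᵥ ((1 - z • F)⁻¹ *ᵥ (z • K)) = _
    rw [Matrix.mulVec_smul, dotProduct_smul, Matrix.dotProduct_mulVec, smul_eq_mul]
  have h1 : y ᵥ* (1 - z • Φ) = (1 - z * (y ⬝ᵥ K)) • cc := by
    have h2 : y ᵥ* (1 - z • F) = cc := by
      rw [hy, Matrix.vecMul_vecMul, Matrix.nonsing_inv_mul _
        ((Matrix.isUnit_iff_isUnit_det _).1 hF), Matrix.vecMul_one]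
    rw [hFe, Matrix.vecMul_add, Matrix.vecMul_smul, Matrix.vecMul_vecMulVec] at h2
    rw [sub_smul, one_smul, mul_smul, eq_sub_iff_add_eq]
    exact h2
  have h3 : y = (1 - z * (y ⬝ᵥ K)) • M.resolventRow p Δ z := by
    have h4 := congrArg (fun v => v ᵥ* (1 - z • Φ)⁻¹) h1
    simp only [Matrix.vecMul_vecMul, Matrix.smul_vecMul] at h4
    rw [Matrix.mul_nonsing_inv _ ((Matrix.isUnit_iff_isUnit_det _).1 hΦ), Matrix.vecMul_one] at h4
    exact h4
  have h5 : y ⬝ᵥ K = (1 - z * (y ⬝ᵥ K)) * (M.resolventRow p Δ z ⬝ᵥ K) := by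
    conv_lhs => rw [h3]
    rw [smul_dotProduct, smul_eq_mul]
  rw [htr, innovationTransfer]
  linear_combination -z * h5

/-- Spectral factorization of the sampled process. -/
lemma hermForm_noiseCov_resolventRow (h : M.IsRiccatiSol p Δ (M.riccati p Δ))
    (hV : M.c p ⬝ᵥ (M.riccati p Δ *ᵥ M.c p) ≠ 0) {z : ℂ} (hz : ‖z‖ = 1)
    (hΦ : IsUnit (1 - z • (M.expA p Δ).map fun x : ℝ => (x : ℂ))) :
    hermForm (M.noiseCov p Δ) (M.resolventRow p Δ z) =
      (M.c p ⬝ᵥ (M.riccati p Δ *ᵥ M.c p)) * ‖M.innovationTransfer p Δ z‖ ^ 2 := by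
  set S := M.riccati p Δ with hS
  set V : ℝ := M.c p ⬝ᵥ (S *ᵥ M.c p) with hVd
  set y := M.resolventRow p Δ z with hy
  set w : Fin p → ℂ := y ᵥ* (M.expA p Δ).map (fun x : ℝ => (x : ℂ)) with hw
  have hSs : Sᵀ = S := (posSemidef_real_iff.1 h.1).1
  have hd : M.expA p Δ *ᵥ (S *ᵥ M.c p) = V • M.gain p Δ := by
    rw [gain, gainOf, smul_smul, mul_inv_cancel₀ hV, one_smul]
  -- The Riccati equation is evaluated as a Hermitian form at the resolvent row y = c + zw, where w
  -- = y e^{AΔ}. For |z| = 1 the forms of `S` at `w` cancel, and what is left is V times the square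
  -- |1 + z yK|².
  have h1 : S + V • Matrix.vecMulVec (M.gain p Δ) (M.gain p Δ) =
      M.expA p Δ * S * (M.expA p Δ)ᵀ + M.noiseCov p Δ := by
    have h2 := h.2
    change S = _ - Matrix.vecMulVec (M.gain p Δ) (M.expA p Δ *ᵥ (S *ᵥ M.c p)) at h2
    rw [hd, Matrix.vecMulVec_smul] at h2
    exact eq_sub_iff_add_eq.1 h2
  have h3 := congrArg (fun B => hermForm B y) h1
  simp only [hermForm_add, hermForm_conj] at h3
  have h4 : hermForm (V • Matrix.vecMulVec (M.gain p Δ) (M.gain p Δ)) y =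
      V * ‖y ⬝ᵥ fun i => (M.gain p Δ i : ℂ)‖ ^ 2 := by
    rw [hermForm, Complex.sq_norm, Complex.normSq_apply, re_dotProduct_ofReal,
      im_dotProduct_ofReal]
    simp only [Matrix.smul_mulVec, dotProduct_smul, dotProduct_vecMulVec_self, smul_eq_mul]
    ring
  have h5 : w ⬝ᵥ (fun i => ((S *ᵥ M.c p) i : ℂ)) =
      V * (y ⬝ᵥ fun i => (M.gain p Δ i : ℂ)) := by
    rw [hw, ← Matrix.dotProduct_mulVec, ← ofReal_mulVec, hd]
    have : (fun i => ((V • M.gain p Δ) i : ℂ)) = (V : ℂ) • fun i => (M.gain p Δ i : ℂ) := by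
      ext i; simp
    rw [this, dotProduct_smul, smul_eq_mul]
  have h6 : hermForm S y = V + 2 * (z * (V * (y ⬝ᵥ fun i => (M.gain p Δ i : ℂ)))).re +
      hermForm S w := by
    conv_lhs => rw [hy, M.resolventRow_eq hΦ]
    rw [hermForm_ofReal_add_smul hSs, ← hy, ← hw, h5, hz]
    ring
  have h7 : ‖M.innovationTransfer p Δ z‖ ^ 2 =
      1 + 2 * (z * (y ⬝ᵥ fun i => (M.gain p Δ i : ℂ))).re +
        ‖y ⬝ᵥ fun i => (M.gain p Δ i : ℂ)‖ ^ 2 := by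
    have h8 : ‖y ⬝ᵥ fun i => (M.gain p Δ i : ℂ)‖ ^ 2 =
        ‖z * (y ⬝ᵥ fun i => (M.gain p Δ i : ℂ))‖ ^ 2 := by rw [norm_mul, hz, one_mul]
    rw [h8, innovationTransfer, ← hy, Complex.sq_norm, Complex.sq_norm, Complex.normSq_apply,
      Complex.normSq_apply]
    simp only [Complex.add_re, Complex.add_im, Complex.one_re, Complex.one_im]
    ring
  rw [h7]
  rw [h4, h6, mul_left_comm z, Complex.re_ofReal_mul] at h3
  linarith

/-! ### The power transfer function of the kernel -/

lemma hasSum_resolvent {B : Matrix (Fin p) (Fin p) ℂ}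
    (h : ∀ z : ℂ, ‖z‖ ≤ 1 → IsUnit (1 - z • B)) {z : ℂ} (hz : ‖z‖ ≤ 1) (x y : Fin p → ℂ) :
    HasSum (fun k : ℕ => z ^ k * (x ⬝ᵥ (B ^ k *ᵥ y))) ((x ᵥ* (1 - z • B)⁻¹) ⬝ᵥ y) := by
  have hs := summable_pow_matrix h hz
  have hinv : (1 - z • B)⁻¹ = ∑' k, (z • B) ^ k :=
    Matrix.inv_eq_left_inv hs.tsum_pow_mul_one_sub
  have := hs.hasSum.map (AddMonoidHom.mk'
    (fun N : Matrix (Fin p) (Fin p) ℂ => x ⬝ᵥ (N *ᵥ y)) fun N N' => by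
      rw [Matrix.add_mulVec, dotProduct_add]) (by
    change Continuous fun N : Matrix (Fin p) (Fin p) ℂ => x ⬝ᵥ (N *ᵥ y)
    fun_prop)
  rw [← hinv] at this
  rw [← Matrix.dotProduct_mulVec]
  refine this.congr_fun fun k => ?_
  change _ = x ⬝ᵥ ((z • B) ^ k *ᵥ y)
  rw [smul_pow, Matrix.smul_mulVec, dotProduct_smul, smul_eq_mul]

/-- For u ∈ (0, Δ] exactly the indices j ≥ 1 contribute, and g(Δ(k+1) - u) = cᵀ (e^{AΔ})^k
e^{A(Δ-u)} e_p sums as a Neumann series. At u = 0 the index j = 0 would add g(0), hence the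
half-open interval. -/
lemma kernelPower_eq (hΔ : 0 < Δ)
    (hst : ∀ z ∈ spectrum ℂ ((M.A p).map fun x : ℝ => (x : ℂ)), z.re < 0) {u : ℝ}
    (hu : u ∈ Set.Ioc 0 Δ) (ω : ℝ) :
    M.kernelPower p Δ u ω = ‖M.resolventRow p Δ (Complex.exp (Complex.I * ω)) ⬝ᵥ
      fun i => ((M.expA p (Δ - u) *ᵥ e p) i : ℂ)‖ ^ 2 := by
  set z : ℂ := Complex.exp (Complex.I * ω) with hz
  have hz1 : ‖z‖ = 1 := by rw [hz, mul_comm]; exact Complex.norm_exp_ofReal_mul_I ω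
  set f : ℤ → ℂ := fun j => (M.kernel p (Δ * j - u) : ℂ) * Complex.exp (Complex.I * j * ω) with hf
  -- Conjugation replaces e^{-ijω} by e^{ijω}, since the kernel is real.
  have h1 : ‖∑' j : ℤ, (M.kernel p (Δ * j - u) : ℂ) * Complex.exp (-(Complex.I * j * ω))‖ =
      ‖∑' j, f j‖ := by
    rw [← Complex.norm_conj, Complex.conj_tsum]
    congr 2
    ext j
    rw [map_mul, Complex.conj_ofReal, ← Complex.exp_conj, hf]
    simp
  have hsupp : Function.support f ⊆ Set.range fun k : ℕ => ((k : ℤ) + 1) := by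
    intro j hj
    by_contra hcon
    have hj0 : j ≤ 0 := by
      by_contra! hj0
      exact hcon ⟨(j - 1).toNat, by simp; omega⟩
    refine hj ?_
    have hneg : ¬ 0 ≤ Δ * j - u := by
      have : Δ * (j : ℝ) ≤ 0 := mul_nonpos_of_nonneg_of_nonpos hΔ.le (by exact_mod_cast hj0)
      linarith [hu.1]
    rw [hf]
    simp only [kernel, if_neg hneg, Complex.ofReal_zero, zero_mul]
  have hinj : Function.Injective fun k : ℕ => ((k : ℤ) + 1) := fun a b hab => by
    simpa using hab
  have hterm : ∀ k : ℕ, f ((k : ℤ) + 1) = z * (z ^ k * ((fun i => (M.c p i : ℂ)) ⬝ᵥ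
      (((M.expA p Δ).map (fun x : ℝ => (x : ℂ))) ^ k *ᵥ
        fun i => ((M.expA p (Δ - u) *ᵥ e p) i : ℂ)))) := by
    intro k
    have hnn : 0 ≤ Δ * (((k : ℤ) + 1 : ℤ) : ℝ) - u := by
      push_cast
      have : 0 ≤ Δ * (k : ℝ) := by positivity
      linarith [hu.2]
    have hexp : Complex.exp (Complex.I * (((k : ℤ) + 1 : ℤ) : ℂ) * ω) = z * z ^ k := by
      rw [← pow_succ', hz, ← Complex.exp_nat_mul]
      congr 1; push_cast; ring
    have hpow : ((M.expA p Δ).map (fun x : ℝ => (x : ℂ))) ^ k =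
        (M.expA p Δ ^ k).map fun x : ℝ => (x : ℂ) :=
      (map_pow (Complex.ofRealHom.mapMatrix : Matrix (Fin p) (Fin p) ℝ →+* _) _ k).symm
    have htime : Δ * (((k : ℤ) + 1 : ℤ) : ℝ) - u = k * Δ + (Δ - u) := by push_cast; ring
    simp only [hf]
    rw [hexp, kernel, if_pos hnn, htime, expA_add, expA_nat_mul, ← Matrix.mulVec_mulVec,
      ofReal_dotProduct_mulVec, hpow]
    ring
  rw [kernelPower, h1, ← hinj.tsum_eq hsupp]
  simp_rw [hterm]
  rw [tsum_mul_left, norm_mul, hz1, one_mul, (hasSum_resolvent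
    (fun z hz => M.isUnit_one_sub_smul_expA hΔ hst hz) hz1.le _ _).tsum_eq]
  rfl

/-! ### Regularity of the transfer functions -/

lemma differentiableAt_vecMul_inv {B : Matrix (Fin p) (Fin p) ℂ} {z : ℂ}
    (h : IsUnit (1 - z • B)) (x y : Fin p → ℂ) :
    DifferentiableAt ℂ (fun z => (x ᵥ* (1 - z • B)⁻¹) ⬝ᵥ y) z := by
  simp only [dotProduct, Matrix.vecMul]
  refine DifferentiableAt.fun_sum fun j _ => DifferentiableAt.mul_const ?_ _
  refine DifferentiableAt.fun_sum fun i _ => DifferentiableAt.const_mul ?_ _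
  exact differentiableAt_inv_one_sub_smul h i j

lemma differentiableAt_innovationTransfer {z : ℂ}
    (h : IsUnit (1 - z • (M.expA p Δ).map fun x : ℝ => (x : ℂ))) :
    DifferentiableAt ℂ (M.innovationTransfer p Δ) z :=
  (differentiableAt_id.mul (differentiableAt_vecMul_inv h _ _)).const_add 1

lemma differentiableAt_transfer {z : ℂ}
    (h : IsUnit (1 - z • (M.F p Δ).map fun x : ℝ => (x : ℂ))) :
    DifferentiableAt ℂ (M.transfer p Δ) z := by
  have : M.transfer p Δ = fun z => 1 - z * (((fun i => (M.c p i : ℂ)) ᵥ*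
      (1 - z • (M.F p Δ).map fun x : ℝ => (x : ℂ))⁻¹) ⬝ᵥ fun i => (M.gain p Δ i : ℂ)) := by
    ext z
    rw [transfer, Matrix.mulVec_smul, dotProduct_smul, Matrix.dotProduct_mulVec, smul_eq_mul]
  rw [this]
  exact (differentiableAt_id.mul (differentiableAt_vecMul_inv h _ _)).const_sub 1

lemma transfer_zero : M.transfer p Δ 0 = 1 := by
  simp [transfer]

lemma innovationTransfer_zero : M.innovationTransfer p Δ 0 = 1 := by
  simp [innovationTransfer]

end CarmaCoeffs

end StableCarma

namespace StableCarma

/-! ### Integrals over the unit circle -/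

lemma norm_exp_I_mul (ω : ℝ) : ‖Complex.exp (Complex.I * ω)‖ = 1 := by
  rw [mul_comm]; exact Complex.norm_exp_ofReal_mul_I ω

/-- The mean value property, shifted by periodicity to (-π, π). -/
lemma integral_circle_eq {H : ℂ → ℂ} (hH : ∀ z : ℂ, ‖z‖ ≤ 1 → DifferentiableAt ℂ H z) :
    ∫ ω in (-Real.pi)..Real.pi, H (Complex.exp (Complex.I * ω)) = 2 * Real.pi * H 0 := by
  have hd : DiffContOnCl ℂ H (Metric.ball 0 |1|) := by
    refine DifferentiableOn.diffContOnCl_ball (U := Metric.closedBall 0 1)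
      (fun z hz => (hH z (mem_closedBall_zero_iff.1 hz)).differentiableWithinAt) (by simp)
  have h1 := hd.circleAverage
  rw [Real.circleAverage] at h1
  have hper : Function.Periodic (fun ω : ℝ => H (circleMap 0 1 ω)) (2 * Real.pi) := fun ω => by
    simp only [periodic_circleMap 0 1 ω]
  have h2 := hper.intervalIntegral_add_eq 0 (-Real.pi)
  rw [zero_add, show -Real.pi + 2 * Real.pi = Real.pi by ring] at h2
  rw [h2] at h1
  have h3 : ∀ ω : ℝ, circleMap 0 1 ω = Complex.exp (Complex.I * ω) := fun ω => by
    simp [circleMap, mul_comm]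
  simp_rw [h3] at h1
  rw [← h1, Complex.real_smul]
  have hpi : (Real.pi : ℂ) ≠ 0 := by exact_mod_cast Real.pi_ne_zero
  push_cast
  field_simp

/-- Nonconstant normalized analytic functions have mean square larger than one. -/
lemma integral_circle_norm_sq_sub_one_pos {H : ℂ → ℂ}
    (hH : ∀ z : ℂ, ‖z‖ ≤ 1 → DifferentiableAt ℂ H z) (h0 : H 0 = 1) {z₀ : ℂ} (hz₀ : ‖z₀‖ = 1)
    (h1 : H z₀ ≠ 1) :
    0 < ∫ ω in (-Real.pi)..Real.pi, (‖H (Complex.exp (Complex.I * ω))‖ ^ 2 - 1) := by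
  have hpi := Real.pi_pos
  have hc : Continuous fun ω : ℝ => H (Complex.exp (Complex.I * ω)) := by
    refine continuous_iff_continuousAt.2 fun ω => ?_
    exact ContinuousAt.comp (f := fun ω : ℝ => Complex.exp (Complex.I * ω))
      (hH _ (norm_exp_I_mul ω).le).continuousAt (by fun_prop)
  have hre : ∫ ω in (-Real.pi)..Real.pi, (H (Complex.exp (Complex.I * ω))).re = 2 * Real.pi := by
    have h2 := congrArg Complex.re (integral_circle_eq hH)
    rw [h0] at h2
    have h3 := intervalIntegral.intervalIntegral_re (f := fun ω : ℝ =>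
      H (Complex.exp (Complex.I * ω))) (hc.intervalIntegrable (μ := volume) (-Real.pi) Real.pi)
    simp at h2
    exact h3.trans h2
  have e : ∫ ω in (-Real.pi)..Real.pi, (‖H (Complex.exp (Complex.I * ω))‖ ^ 2 - 1) =
      ∫ ω in (-Real.pi)..Real.pi, ‖H (Complex.exp (Complex.I * ω)) - 1‖ ^ 2 := by
    -- The linear term Re H - 1 integrates to zero by the mean value property, leaving the square |H
    -- - 1|².
    have h4 : ∀ ω : ℝ, ‖H (Complex.exp (Complex.I * ω))‖ ^ 2 - 1 =
        ‖H (Complex.exp (Complex.I * ω)) - 1‖ ^ 2 +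
          2 * ((H (Complex.exp (Complex.I * ω))).re - 1) := fun ω => by
      simp only [Complex.sq_norm, Complex.normSq_apply, Complex.sub_re, Complex.sub_im,
        Complex.one_re, Complex.one_im]
      ring
    simp_rw [h4]
    have hcr : Continuous fun ω : ℝ => (H (Complex.exp (Complex.I * ω))).re :=
      Complex.continuous_re.comp hc
    rw [intervalIntegral.integral_add, intervalIntegral.integral_const_mul,
      intervalIntegral.integral_sub, hre]
    · simp; ring
    · exact hcr.intervalIntegrable _ _
    · exact intervalIntegrable_const
    · exact ((hc.sub continuous_const).norm.pow 2).intervalIntegrable _ _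
    · exact (continuous_const.mul (hcr.sub continuous_const)).intervalIntegrable _ _
  rw [e]
  refine intervalIntegral.integral_pos (by linarith)
    ((hc.sub continuous_const).norm.pow 2).continuousOn (fun _ _ => sq_nonneg _)
    ⟨z₀.arg, ⟨(Complex.neg_pi_lt_arg z₀).le, Complex.arg_le_pi z₀⟩, ?_⟩
  have hz : Complex.exp (Complex.I * z₀.arg) = z₀ := by
    have := Complex.norm_mul_exp_arg_mul_I z₀
    rwa [hz₀, Complex.ofReal_one, one_mul, mul_comm] at this
  simp only [hz]
  have : 0 < ‖H z₀ - 1‖ := norm_pos_iff.2 (sub_ne_zero.2 h1)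
  positivity

/-! ### Continuity and averages of the kernel powers -/

namespace CarmaCoeffs

variable {p : ℕ} {M : CarmaCoeffs} {Δ : ℝ}

lemma continuous_transferPower
    (hF : ∀ z : ℂ, ‖z‖ ≤ 1 → IsUnit (1 - z • (M.F p Δ).map fun x : ℝ => (x : ℂ))) :
    Continuous (M.transferPower p Δ) := by
  refine Continuous.pow (Continuous.norm (continuous_iff_continuousAt.2 fun ω => ?_)) 2
  exact ContinuousAt.comp (f := fun ω : ℝ => Complex.exp (Complex.I * ω))
    (M.differentiableAt_transfer (hF _ (norm_exp_I_mul ω).le)).continuousAt (by fun_prop)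

lemma continuous_resolventRow_exp
    (hΦ : ∀ z : ℂ, ‖z‖ ≤ 1 → IsUnit (1 - z • (M.expA p Δ).map fun x : ℝ => (x : ℂ))) :
    Continuous fun ω : ℝ => M.resolventRow p Δ (Complex.exp (Complex.I * ω)) := by
  simp only [resolventRow]
  refine Continuous.matrix_vecMul continuous_const ?_
  refine continuous_pi fun i => continuous_pi fun j => ?_
  refine continuous_iff_continuousAt.2 fun ω => ?_
  exact ContinuousAt.comp (f := fun ω : ℝ => Complex.exp (Complex.I * ω))
    (differentiableAt_inv_one_sub_smul (hΦ _ (norm_exp_I_mul ω).le) i j).continuousAt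
    (by fun_prop)

/-- The continuous version of the power transfer function of the kernel on `[0, Δ]`. -/
noncomputable def kernelPowerExt (p : ℕ) (M : CarmaCoeffs) (Δ u ω : ℝ) : ℝ :=
  ‖M.resolventRow p Δ (Complex.exp (Complex.I * ω)) ⬝ᵥ
    fun i => ((M.expA p (Δ - u) *ᵥ e p) i : ℂ)‖ ^ 2

lemma continuous_kernelPowerExt
    (hΦ : ∀ z : ℂ, ‖z‖ ≤ 1 → IsUnit (1 - z • (M.expA p Δ).map fun x : ℝ => (x : ℂ))) :
    Continuous fun x : ℝ × ℝ => M.kernelPowerExt p Δ x.1 x.2 := by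
  have h1 := M.continuous_resolventRow_exp hΦ
  have h2 : Continuous fun u : ℝ => M.expA p (Δ - u) *ᵥ e p :=
    (M.continuous_expA.comp (continuous_const.sub continuous_id)).matrix_mulVec continuous_const
  have h3 : Continuous fun u : ℝ => fun i => ((M.expA p (Δ - u) *ᵥ e p) i : ℂ) :=
    continuous_pi fun i => Complex.continuous_ofReal.comp ((continuous_apply i).comp h2)
  exact (((h1.comp continuous_snd).dotProduct (h3.comp continuous_fst)).norm).pow 2

/-- The average of the kernel powers over one sampling interval. -/
lemma integral_kernelPowerExt (h : M.IsRiccatiSol p Δ (M.riccati p Δ))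
    (hV : M.c p ⬝ᵥ (M.riccati p Δ *ᵥ M.c p) ≠ 0)
    (hΦ : ∀ z : ℂ, ‖z‖ ≤ 1 → IsUnit (1 - z • (M.expA p Δ).map fun x : ℝ => (x : ℂ))) (ω : ℝ) :
    ∫ u in (0 : ℝ)..Δ, M.kernelPowerExt p Δ u ω =
      (M.c p ⬝ᵥ (M.riccati p Δ *ᵥ M.c p)) *
        ‖M.innovationTransfer p Δ (Complex.exp (Complex.I * ω))‖ ^ 2 := by
  rw [← M.hermForm_noiseCov_resolventRow h hV (norm_exp_I_mul ω) (hΦ _ (norm_exp_I_mul ω).le),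
    hermForm_noiseCov]
  -- The substitution u ↦ Δ - u reverses time and produces the noise covariance integral.
  have := intervalIntegral.integral_comp_sub_left (a := 0) (b := Δ)
    (fun u => ‖M.resolventRow p Δ (Complex.exp (Complex.I * ω)) ⬝ᵥ
      fun i => ((M.expA p u *ᵥ e p) i : ℂ)‖ ^ 2) Δ
  rw [sub_self, sub_zero] at this
  exact this

lemma integral_mul_kernelPower_eq (hΔ : 0 < Δ)
    (hst : ∀ z ∈ spectrum ℂ ((M.A p).map fun x : ℝ => (x : ℂ)), z.re < 0) (h : ℝ → ℝ) {u : ℝ}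
    (hu : u ∈ Set.Ioc 0 Δ) :
    ∫ ω in (-Real.pi)..Real.pi, h ω * M.kernelPower p Δ u ω =
      ∫ ω in (-Real.pi)..Real.pi, h ω * M.kernelPowerExt p Δ u ω := by
  simp_rw [M.kernelPower_eq hΔ hst hu, kernelPowerExt]

lemma continuous_integral_mul_kernelPowerExt
    (hΦ : ∀ z : ℂ, ‖z‖ ≤ 1 → IsUnit (1 - z • (M.expA p Δ).map fun x : ℝ => (x : ℂ)))
    {h : ℝ → ℝ} (hh : Continuous h) :
    Continuous fun u => ∫ ω in (-Real.pi)..Real.pi, h ω * M.kernelPowerExt p Δ u ω :=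
  intervalIntegral.continuous_parametric_intervalIntegral_of_continuous'
    (f := fun u ω => h ω * M.kernelPowerExt p Δ u ω)
    ((hh.comp continuous_snd).mul (M.continuous_kernelPowerExt hΦ)) _ _

lemma integral_integral_mul_kernelPowerExt
    (hR : M.IsRiccatiSol p Δ (M.riccati p Δ)) (hV : M.c p ⬝ᵥ (M.riccati p Δ *ᵥ M.c p) ≠ 0)
    (hΦ : ∀ z : ℂ, ‖z‖ ≤ 1 → IsUnit (1 - z • (M.expA p Δ).map fun x : ℝ => (x : ℂ)))
    {h : ℝ → ℝ} (hh : Continuous h) :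
    ∫ u in (0 : ℝ)..Δ, ∫ ω in (-Real.pi)..Real.pi, h ω * M.kernelPowerExt p Δ u ω =
      (M.c p ⬝ᵥ (M.riccati p Δ *ᵥ M.c p)) * ∫ ω in (-Real.pi)..Real.pi,
        h ω * ‖M.innovationTransfer p Δ (Complex.exp (Complex.I * ω))‖ ^ 2 := by
  have hc : Continuous fun x : ℝ × ℝ => h x.2 * M.kernelPowerExt p Δ x.1 x.2 :=
    (hh.comp continuous_snd).mul (M.continuous_kernelPowerExt hΦ)
  rw [intervalIntegral_intervalIntegral_swap (F := fun u ω => h ω * M.kernelPowerExt p Δ u ω)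
    ((hc.continuousOn.integrableOn_compact (isCompact_uIcc.prod isCompact_uIcc)).mono_set
      (Set.prod_mono Set.uIoc_subset_uIcc Set.uIoc_subset_uIcc)),
    ← intervalIntegral.integral_const_mul]
  congr 1
  ext ω
  rw [intervalIntegral.integral_const_mul, M.integral_kernelPowerExt hR hV hΦ]
  ring

end CarmaCoeffs

end StableCarma

namespace StableCarma

/-! ### Positivity of the averaged gap -/

section Limit

variable {N p : ℕ} {Δ : ℝ} {Θ : Set (EuclideanSpace ℝ (Fin N))} {ϑ₀ : EuclideanSpace ℝ (Fin N)}
  {M : EuclideanSpace ℝ (Fin N) → CarmaCoeffs}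

lemma StandingAssumptions.isUnit_expA (hA : StandingAssumptions p Δ Θ ϑ₀ M) (hΔ : 0 < Δ)
    {ϑ : EuclideanSpace ℝ (Fin N)} (hϑ : ϑ ∈ Θ) (z : ℂ) (hz : ‖z‖ ≤ 1) :
    IsUnit (1 - z • ((M ϑ).expA p Δ).map fun x : ℝ => (x : ℂ)) :=
  (M ϑ).isUnit_one_sub_smul_expA hΔ (hA.stable ϑ hϑ) hz

lemma StandingAssumptions.isRiccatiSol (hA : StandingAssumptions p Δ Θ ϑ₀ M) (hΔ : 0 < Δ)
    {ϑ : EuclideanSpace ℝ (Fin N)} (hϑ : ϑ ∈ Θ) :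
    (M ϑ).IsRiccatiSol p Δ ((M ϑ).riccati p Δ) :=
  (M ϑ).isRiccatiSol_riccati hΔ (hA.stable ϑ hϑ) (hA.ma_ne ϑ hϑ)

lemma StandingAssumptions.isUnit_F (hA : StandingAssumptions p Δ Θ ϑ₀ M) (hΔ : 0 < Δ)
    {ϑ : EuclideanSpace ℝ (Fin N)} (hϑ : ϑ ∈ Θ) (z : ℂ) (hz : ‖z‖ ≤ 1) :
    IsUnit (1 - z • ((M ϑ).F p Δ).map fun x : ℝ => (x : ℂ)) :=
  (M ϑ).isUnit_one_sub_smul_F hΔ (hA.isRiccatiSol hΔ hϑ) hz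

/-- The continuous version of `G` on `[0, Δ]`. -/
noncomputable def limitGap (p : ℕ) (Δ : ℝ) (ϑ₀ : EuclideanSpace ℝ (Fin N))
    (M : EuclideanSpace ℝ (Fin N) → CarmaCoeffs) (ϑ : EuclideanSpace ℝ (Fin N)) (u : ℝ) : ℝ :=
  1 / (2 * Real.pi) * ∫ w in (-Real.pi)..Real.pi,
    ((M ϑ).transferPower p Δ w - (M ϑ₀).transferPower p Δ w) * (M ϑ₀).kernelPowerExt p Δ u w

lemma StandingAssumptions.continuous_limitGap (hA : StandingAssumptions p Δ Θ ϑ₀ M)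
    (hΔ : 0 < Δ) {ϑ : EuclideanSpace ℝ (Fin N)} (hϑ : ϑ ∈ Θ) :
    Continuous (limitGap p Δ ϑ₀ M ϑ) := by
  have h₀ := interior_subset hA.mem_interior
  exact continuous_const.mul
    ((M ϑ₀).continuous_integral_mul_kernelPowerExt (hA.isUnit_expA hΔ h₀)
      (((M ϑ).continuous_transferPower (hA.isUnit_F hΔ hϑ)).sub
        ((M ϑ₀).continuous_transferPower (hA.isUnit_F hΔ h₀))))

lemma StandingAssumptions.G_eq_limitGap (hA : StandingAssumptions p Δ Θ ϑ₀ M) (hΔ : 0 < Δ)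
    (ϑ : EuclideanSpace ℝ (Fin N)) {u : ℝ} (hu : u ∈ Set.Ioc 0 Δ) :
    G p Δ ϑ₀ M ϑ u = limitGap p Δ ϑ₀ M ϑ u := by
  rw [G, limitGap, (M ϑ₀).integral_mul_kernelPower_eq hΔ
    (hA.stable _ (interior_subset hA.mem_interior)) (fun w => (M ϑ).transferPower p Δ w -
      (M ϑ₀).transferPower p Δ w) hu]

lemma StandingAssumptions.limitGap_eq (hA : StandingAssumptions p Δ Θ ϑ₀ M) (hΔ : 0 < Δ)
    {ϑ : EuclideanSpace ℝ (Fin N)} (hϑ : ϑ ∈ Θ) {u : ℝ} (hu : u ∈ Set.Ioc 0 Δ) :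
    limitGap p Δ ϑ₀ M ϑ u = 1 / (2 * Real.pi) *
      ((∫ w in (-Real.pi)..Real.pi, (M ϑ).transferPower p Δ w * (M ϑ₀).kernelPower p Δ u w) -
        ∫ w in (-Real.pi)..Real.pi, (M ϑ₀).transferPower p Δ w * (M ϑ₀).kernelPower p Δ u w) := by
  have h₀ := interior_subset hA.mem_interior
  have hk : Continuous fun w => (M ϑ₀).kernelPowerExt p Δ u w :=
    ((M ϑ₀).continuous_kernelPowerExt (hA.isUnit_expA hΔ h₀)).comp
      (f := fun w : ℝ => (u, w)) (by fun_prop)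
  have hi : ∀ {ϑ'}, ϑ' ∈ Θ → IntervalIntegrable
      (fun w => (M ϑ').transferPower p Δ w * (M ϑ₀).kernelPowerExt p Δ u w) volume
      (-Real.pi) Real.pi := fun hϑ' =>
    (((M _).continuous_transferPower (hA.isUnit_F hΔ hϑ')).mul hk).intervalIntegrable _ _
  rw [(M ϑ₀).integral_mul_kernelPower_eq hΔ (hA.stable _ h₀) ((M ϑ).transferPower p Δ) hu,
    (M ϑ₀).integral_mul_kernelPower_eq hΔ (hA.stable _ h₀) ((M ϑ₀).transferPower p Δ) hu, limitGap,
    ← intervalIntegral.integral_sub (hi hϑ) (hi h₀)]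
  simp_rw [sub_mul]

/-- The prediction error variance is uniquely minimal at the true parameter. -/
lemma StandingAssumptions.integral_limitGap_pos (hA : StandingAssumptions p Δ Θ ϑ₀ M)
    (hΔ : 0 < Δ) {ϑ : EuclideanSpace ℝ (Fin N)} (hϑ : ϑ ∈ Θ) (hne : ϑ ≠ ϑ₀) :
    0 < ∫ u in (0 : ℝ)..Δ, limitGap p Δ ϑ₀ M ϑ u := by
  have hpi := Real.pi_pos
  have h₀ := interior_subset hA.mem_interior
  have hR := hA.isRiccatiSol hΔ h₀
  have hV := (M ϑ₀).predictionVariance_pos hΔ hR (hA.ma_ne _ h₀)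
  have hinv : ∀ z : ℂ, ‖z‖ ≤ 1 →
      (M ϑ₀).transfer p Δ z * (M ϑ₀).innovationTransfer p Δ z = 1 := fun z hz =>
    (M ϑ₀).transfer_mul_innovationTransfer (hA.isUnit_expA hΔ h₀ z hz) (hA.isUnit_F hΔ h₀ z hz)
  simp only [limitGap]
  rw [intervalIntegral.integral_const_mul,
    (M ϑ₀).integral_integral_mul_kernelPowerExt hR hV.ne' (hA.isUnit_expA hΔ h₀)
      (h := fun w => (M ϑ).transferPower p Δ w - (M ϑ₀).transferPower p Δ w)
      (((M ϑ).continuous_transferPower (hA.isUnit_F hΔ hϑ)).sub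
        ((M ϑ₀).continuous_transferPower (hA.isUnit_F hΔ h₀)))]
  refine mul_pos (by positivity) (mul_pos hV ?_)
  obtain ⟨z₀, hz₀, hzne⟩ := hA.identifiable ϑ hϑ ϑ₀ h₀ hne
  -- H is the quotient of the two transfer functions, written as a product with the inverse filter
  -- so that analyticity on the closed disc is evident. H = 1 at the separating point would equate
  -- the transfer functions there.
  have key := integral_circle_norm_sq_sub_one_pos
    (H := fun z => (M ϑ).transfer p Δ z * (M ϑ₀).innovationTransfer p Δ z)
    (fun z hz => ((M ϑ).differentiableAt_transfer (hA.isUnit_F hΔ hϑ z hz)).mul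
      ((M ϑ₀).differentiableAt_innovationTransfer (hA.isUnit_expA hΔ h₀ z hz)))
    (by simp [CarmaCoeffs.transfer_zero, CarmaCoeffs.innovationTransfer_zero]) hz₀ (fun h => by
      have h2 := hinv z₀ hz₀.le
      exact hzne (mul_right_cancel₀ (right_ne_zero_of_mul_eq_one h2) (h.trans h2.symm)))
  refine key.trans_eq (intervalIntegral.integral_congr fun ω _ => ?_)
  have h2 := congrArg (fun z => ‖z‖ ^ 2) (hinv _ (norm_exp_I_mul ω).le)
  simp only [norm_mul, mul_pow, norm_one, one_pow] at h2
  simp only [CarmaCoeffs.transferPower, norm_mul, mul_pow, sub_mul, h2]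

/-- If the integral were not positive, continuity would force the gap to vanish on [0, Δ], against
the positivity of its plain integral. -/
lemma StandingAssumptions.integral_abs_limitGap_rpow_pos (hA : StandingAssumptions p Δ Θ ϑ₀ M)
    (hΔ : 0 < Δ) {ϑ : EuclideanSpace ℝ (Fin N)} (hϑ : ϑ ∈ Θ) (hne : ϑ ≠ ϑ₀) {r : ℝ}
    (hr : 0 < r) : 0 < ∫ u in (0 : ℝ)..Δ, |limitGap p Δ ϑ₀ M ϑ u| ^ r := by
  have hc := hA.continuous_limitGap hΔ hϑ
  refine intervalIntegral.integral_pos hΔ (hc.abs.rpow_const fun _ => Or.inr hr.le).continuousOn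
    (fun _ _ => Real.rpow_nonneg (abs_nonneg _) _) ?_
  by_contra! hcon
  have h0 : ∀ u ∈ Set.uIcc 0 Δ, limitGap p Δ ϑ₀ M ϑ u = 0 := fun u hu => by
    rw [Set.uIcc_of_le hΔ.le] at hu
    by_contra hu0
    exact absurd (hcon u hu) (not_le.2 (Real.rpow_pos_of_pos (abs_pos.2 hu0) r))
  have h1 := hA.integral_limitGap_pos hΔ hϑ hne
  rw [intervalIntegral.integral_congr (g := fun _ => (0 : ℝ)) h0] at h1
  simp at h1

end Limit

end StableCarma

/-! ### Existence and law of the limit field -/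

theorem corollary4p2 {N p : ℕ} (Δ α σ : ℝ) (hΔ : 0 < Δ) (hα : α ∈ Set.Ioo (0 : ℝ) 2) (hσ : 0 < σ)
    (Θ : Set (EuclideanSpace ℝ (Fin N))) (ϑ₀ : EuclideanSpace ℝ (Fin N))
    (M : EuclideanSpace ℝ (Fin N) → StableCarma.CarmaCoeffs)
    (hA : StableCarma.StandingAssumptions p Δ Θ ϑ₀ M)
    {Ω : Type*} [MeasurableSpace Ω] (P : Measure Ω) [IsProbabilityMeasure P] (L : ℝ≥0 → Ω → ℝ)
    (hL : StableCarma.IsStableLevyProcess L P (α / 2)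
      (σ ^ 2 * (StableCarma.stableConst α / StableCarma.stableConst (α / 2)) ^ (2 / α)) 1) :
    (∃ W : EuclideanSpace ℝ (Fin N) → Ω → ℝ,
      StableCarma.IsLimitField p Δ Θ ϑ₀ M L P (α / 2) W) ∧
    ∀ W : EuclideanSpace ℝ (Fin N) → Ω → ℝ,
      StableCarma.IsLimitField p Δ Θ ϑ₀ M L P (α / 2) W →
      ∀ ϑ ∈ Θ, ϑ ≠ ϑ₀ →
        StableCarma.HasStableLaw (fun ω => W ϑ ω - W ϑ₀ ω) P (α / 2)
          (StableCarma.limitScale p Δ ϑ₀ M α σ ϑ) (StableCarma.limitSkew p Δ ϑ₀ M α ϑ) 0 := by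
  have hr : 0 < α / 2 := by linarith [hα.1]
  have hr1 : α / 2 < 1 := by linarith [hα.2]
  have h₀ : ϑ₀ ∈ Θ := interior_subset hA.mem_interior
  have hCα := StableCarma.stableConst_pos hα
  have hCr := StableCarma.stableConst_pos (r := α / 2) ⟨hr, by linarith⟩
  have hα0 : α ≠ 0 := hα.1.ne'
  refine ⟨?_, fun W hW ϑ hϑ hne => ?_⟩
  · have hJ : ∀ ϑ ∈ Θ, ∃ J : Ω → ℝ, StableCarma.IsStableIntegral L P (α / 2) Δ
        (fun s => ∫ w in (-Real.pi)..Real.pi,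
          (M ϑ).transferPower p Δ w * (M ϑ₀).kernelPower p Δ s w) J := fun ϑ hϑ =>
      StableCarma.exists_isStableIntegral hL hr hr1 hΔ.le
        ((M ϑ₀).continuous_integral_mul_kernelPowerExt (hA.isUnit_expA hΔ h₀)
          ((M ϑ).continuous_transferPower (hA.isUnit_F hΔ hϑ)))
        fun u hu => (M ϑ₀).integral_mul_kernelPower_eq hΔ (hA.stable _ h₀) _ hu
    choose! J hJ using hJ
    exact ⟨fun ϑ ω => 1 / (2 * Real.pi) * J ϑ ω, fun ϑ hϑ => ⟨J ϑ, hJ ϑ hϑ, fun _ => rfl⟩⟩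
  · obtain ⟨J, hJ, hWJ⟩ := hW ϑ hϑ
    obtain ⟨J₀, hJ₀, hWJ₀⟩ := hW ϑ₀ h₀
    -- The integrand of the difference is identified with `G` on (0, Δ] only; the point 0 does not
    -- affect the integrals.
    have hG : ∀ u ∈ Set.Ioc 0 Δ, 1 / (2 * Real.pi) *
        ((∫ w in (-Real.pi)..Real.pi, (M ϑ).transferPower p Δ w * (M ϑ₀).kernelPower p Δ u w) -
        ∫ w in (-Real.pi)..Real.pi, (M ϑ₀).transferPower p Δ w * (M ϑ₀).kernelPower p Δ u w) =
        StableCarma.G p Δ ϑ₀ M ϑ u := fun u hu => by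
      rw [hA.G_eq_limitGap hΔ ϑ hu, hA.limitGap_eq hΔ hϑ hu]
    have hcongr : ∀ F : ℝ → ℝ, ∫ u in (0 : ℝ)..Δ, F (1 / (2 * Real.pi) *
        ((∫ w in (-Real.pi)..Real.pi, (M ϑ).transferPower p Δ w * (M ϑ₀).kernelPower p Δ u w) -
        ∫ w in (-Real.pi)..Real.pi, (M ϑ₀).transferPower p Δ w * (M ϑ₀).kernelPower p Δ u w)) =
        ∫ u in (0 : ℝ)..Δ, F (StableCarma.G p Δ ϑ₀ M ϑ u) := fun F => by
      rw [intervalIntegral.integral_of_le hΔ.le, intervalIntegral.integral_of_le hΔ.le]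
      exact setIntegral_congr_fun measurableSet_Ioc fun u hu => by rw [hG u hu]
    have hpos : 0 < ∫ u in (0 : ℝ)..Δ, |StableCarma.G p Δ ϑ₀ M ϑ u| ^ (α / 2) := by
      refine (hA.integral_abs_limitGap_rpow_pos hΔ hϑ hne hr).trans_eq ?_
      rw [intervalIntegral.integral_of_le hΔ.le, intervalIntegral.integral_of_le hΔ.le]
      exact setIntegral_congr_fun measurableSet_Ioc fun u hu => by
        rw [hA.G_eq_limitGap hΔ ϑ hu]
    have hτ : 0 < σ ^ 2 *
        (StableCarma.stableConst α / StableCarma.stableConst (α / 2)) ^ (2 / α) := by positivity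
    -- The exponents 2/α and α/2 cancel, which gives the constant in the scale.
    have hτr : (σ ^ 2 * (StableCarma.stableConst α / StableCarma.stableConst (α / 2)) ^ (2 / α)) ^
        (α / 2) = σ ^ α * StableCarma.stableConst α / StableCarma.stableConst (α / 2) := by
      rw [Real.mul_rpow (by positivity) (by positivity), ← Real.rpow_mul (by positivity),
        ← Real.rpow_natCast σ 2, ← Real.rpow_mul hσ.le, div_mul_div_cancel₀ hα0,
        div_self two_ne_zero, Real.rpow_one, Nat.cast_ofNat, mul_div_cancel₀ _ two_ne_zero,
        mul_div_assoc]
    have hlaw := (hJ.sub hr hr1 hJ₀).hasStableLaw hL hr hr1 hΔ.le hτ (1 / (2 * Real.pi))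
      (by rw [hcongr fun x => |x| ^ (α / 2)]; exact hpos)
    rw [hcongr fun x => |x| ^ (α / 2),
      hcongr fun x => max 0 x ^ (α / 2) - max 0 (-x) ^ (α / 2), hτr, one_div_div] at hlaw
    have hW' : (fun ω => W ϑ ω - W ϑ₀ ω) = fun ω => 1 / (2 * Real.pi) * (J ω - J₀ ω) := by
      ext ω
      rw [hWJ, hWJ₀, mul_sub]
    rw [hW']
    exact hlaw
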